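/- **Setting.** Let $G=(V,E)$ be a finite connected simple graph with $N=|V|$ vertices and $K=|E|\ge 2$ edges, such that every vertex has degree less than $z$ and, for every edge $e$ and every $l\ge1$, at most $\gamma^l$ connected sets of $l$ edges contain $e$. Each vertex carries a spin with Hilbert space $\mathbb C^d$, $d\ge 1$. Let $H=\sum_{e\in E}h_e$, where each $h_e$ is Hermitian, acts non-trivially only on the two ends of $e$, and has operator norm $\|h_e\|\le 1$. Write $\|A\|_1=\operatorname{tr}(A^\dagger A)^{1/2}$. An operator $\rho$ is a PEPO on $G$ of bond dimension $D$ if $\rho=\sum_{\alpha:E\to\{1,\dots,D\}}\bigotimes_{v\in V}X^v_{(\alpha(e))_{e\ni v}}$ with operators $X^v_{\cdots}$ on $\mathbb C^d$; PEPS are defined in the same way with vectors in $\mathbb C^d$ in place of operators. Fix an enumeration $h_1,\dots,h_K$ of the interaction terms. For integers $M\ge 1$, $L\ge0$, $\beta\ge 0$, and $1\le i\le 2K$ put $\tilde h_i=h_{K+1-i}$ if $i\le K$, $\tilde h_i=h_{i-K}$ if $i>K$, and $x_i=e^{-\beta\tilde h_i/2M}-1$. With $\tau=\prod_{i=1}^K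 e^{-\beta h_i/2M}$ one has $(\tau^\dagger\tau)^M=\prod_{j=1}^M\prod_{i=1}^{2K}(1+x_i)$. The truncated Trotter expansion is $$\tilde\rho=\tilde\rho_{M,L}=\sum_{\lambda}\ \prod_{j=1}^M\prod_{i=1}^{2K}x_i^{\lambda_{j,i}},$$ where $\lambda$ runs over the $M\times 2K$ matrices with entries in $\{0,1\}$ and at most $L$ ones in every column. **(a) Gibbs states.** For every $b\ge0$ there are $C>0$ and $p\in\mathbb N$, depending only on $b$, and for every $d\ge 1$ there is $C'>0$, depending only on $b$ and $d$, such that for every system as above (with any $z$, $\gamma$), every $0\le\beta\le b\log N$ and every $0<\varepsilon\le1$ there are integers $M\ge1$ and $L$ with $$M\le C\,(K/\varepsilon)^p,\qquad L\le C\log(K/\varepsilon),\qquad \|e^{-\beta H}-\tilde\rho_{M,L}\|_1\le\varepsilon\,\|e^{-\beta H}\|_1 .$$ Moreover each $x_i$ is a sum of $d^2$ products of one-site operators at the two ends of its edge; and whenever $1\le s\le d^2$ and every $x_i$ is a sum of $s$ such products, $\tilde\rho_{M,L}$ is a PEPO on $G$ of a bond dimension $D$ with $$D\le L^2(sM)^{2L}\qquad\text{and}\qquad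 D\le e^{C'\log^2(N/\varepsilon)} .$$ In particular the constants do not depend on $z$ or $\gamma$, hence not on a lattice dimension. **(b) Ground states.** For all $d\ge1$, $\Delta>0$ and $\kappa\ge0$ there is $C>0$, depending only on $d,\Delta,\kappa$, such that the following holds for every system as above. Suppose that $H$ has a normalised ground state $\Psi$ of energy $E_0$, that every eigenvector orthogonal to $\Psi$ has eigenvalue at least $E_0+\Delta$, and that for every $E\ge0$ the number of eigenvalues of $H$ (with multiplicity) that are at most $E_0+E$ is at most $N^{\kappa(1+E)}$. Then for every $0<\varepsilon\le 1$ there are $D\le e^{C\log^2(N/\varepsilon)}$, a PEPO $\sigma$ on $G$ of bond dimension $D$ with $\big\||\Psi\rangle\langle\Psi|-\sigma\big\|_1\le\varepsilon$, and a PEPS $\Phi$ on $G$ of bond dimension $D$ with $\|\Psi-\Phi\|\le\varepsilon$. -/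

import Mathlib

open scoped Matrix Matrix.Norms.L2Operator

universe u

namespace GibbsPEPO

noncomputable section

/-- Operators on the Hilbert space `⨂_{v ∈ V} ℂ^d` of spins of dimension `d` sitting at the
vertices, written in the product basis, which is indexed by the configurations `V → Fin d`.
The norm `‖A‖` on it is the operator norm. -/
abbrev Op (V : Type u) (d : ℕ) : Type u := Matrix (V → Fin d) (V → Fin d) ℂ

variable {V : Type u} [Fintype V] [DecidableEq V] {d : ℕ}

/-- The tensor product `⨂_v A_v` of one-site operators. -/
def siteTensor (A : V → Matrix (Fin d) (Fin d) ℂ) : Op V d :=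
  Matrix.of fun σ τ => ∏ v, A v (σ v) (τ v)

/-- `A` acts non-trivially only on the spins in `S`, that is `A = a ⊗ 1` with `a` an operator on
the spins in `S`. -/
def ActsOn (S : Set V) (A : Op V d) : Prop :=
  ∃ a : Matrix (S → Fin d) (S → Fin d) ℂ, ∀ σ τ : V → Fin d,
    ((∀ v ∉ S, σ v = τ v) → A σ τ = a (fun v => σ v) (fun v => τ v)) ∧
    ((∃ v ∉ S, σ v ≠ τ v) → A σ τ = 0)

/-- The trace norm (Schatten 1-norm) `tr (A† A)^{1/2}`: the sum of the singular values. -/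
def traceNorm {n : Type*} [Fintype n] [DecidableEq n] (A : Matrix n n ℂ) : ℝ :=
  ∑ i, √((Matrix.isHermitian_conjTranspose_mul_self A).eigenvalues i)

/-- A set of edges is connected: any two of its edges are joined by a chain of its edges in which
consecutive ones share a vertex. -/
def EdgeConnected (I : Set (Sym2 V)) : Prop :=
  ∀ e ∈ I, ∀ f ∈ I,
    Relation.ReflTransGen (fun a b : Sym2 V => b ∈ I ∧ ∃ v, v ∈ a ∧ v ∈ b) e f

/-- The lattice growth constant of `G` is at most `γ`: each edge lies in at most `γ ^ l` connected
sets of `l` edges. -/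
def LatticeGrowthLE (G : SimpleGraph V) (γ : ℝ) : Prop :=
  ∀ e ∈ G.edgeSet, ∀ l : ℕ, 1 ≤ l →
    ({I : Finset (Sym2 V) | (I : Set (Sym2 V)) ⊆ G.edgeSet ∧ EdgeConnected (I : Set (Sym2 V)) ∧
      e ∈ I ∧ I.card = l}.ncard : ℝ) ≤ γ ^ l

variable (G : SimpleGraph V) [DecidableRel G.Adj]

/-- The interaction `h` assigns to every edge a Hermitian operator of norm at most one that acts
on the two ends of the edge only. -/
def IsInteraction (h : G.edgeSet → Op V d) : Prop :=
  ∀ e, (h e).IsHermitian ∧ ActsOn {v | v ∈ (e : Sym2 V)} (h e) ∧ ‖h e‖ ≤ 1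

variable {G}

/-- The Hamiltonian `H = ∑_e h_e`. -/
def hamiltonian (h : G.edgeSet → Op V d) : Op V d := ∑ e, h e

theorem isHermitian_hamiltonian {h : G.edgeSet → Op V d} (hh : IsInteraction G h) :
    (hamiltonian h).IsHermitian := by
  unfold hamiltonian Matrix.IsHermitian
  rw [Matrix.conjTranspose_sum]
  exact Finset.sum_congr rfl fun e _ => (hh e).1

/-- The unnormalised Gibbs operator `e^{-βH}`. -/
def gibbs (β : ℝ) (h : G.edgeSet → Op V d) : Op V d :=
  NormedSpace.exp (((-β : ℝ) : ℂ) • hamiltonian h)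

/-- The `2K` columns of one Trotter step `τ†τ`, where `τ = ∏_{i=1}^K e^{-βh_i/2M}`: the columns
`1, …, K` carry the interaction terms in decreasing order, the columns `K+1, …, 2K` in increasing
order. -/
def column (K : ℕ) : Fin (K + K) → Fin K := Fin.addCases Fin.rev id

/-- `x_i = e^{-β h̃_i / 2M} - 1`, where `h̃_i` is the interaction term of column `i`. -/
def trotterTerm {K : ℕ} (ord : Fin K ≃ G.edgeSet) (h : G.edgeSet → Op V d) (β : ℝ) (M : ℕ)
    (i : Fin (K + K)) : Op V d :=
  NormedSpace.exp (((-(β / (2 * M)) : ℝ) : ℂ) • h (ord (column K i))) - 1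

/-- The truncated Trotter expansion: the terms `∏_{j=1}^M ∏_{i=1}^{2K} x_i ^ λ_{ji}` of the
expanded product `(τ†τ)^M = ∏_{j=1}^M ∏_{i=1}^{2K} (1 + x_i)`, summed over the 0-1 tables `λ` with
at most `L` ones in each column. The products are ordered, row by row, from left to right. -/
def truncatedTrotter {K : ℕ} (ord : Fin K ≃ G.edgeSet) (h : G.edgeSet → Op V d) (β : ℝ)
    (M L : ℕ) : Op V d :=
  ∑ t : Fin M → Fin (K + K) → Fin 2 with ∀ i, ∑ j, (t j i : ℕ) ≤ L,
    ((List.finRange M).map fun j =>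
      ((List.finRange (K + K)).map fun i =>
        trotterTerm ord h β M i ^ (t j i : ℕ)).prod).prod

/-- `A` has a decomposition `∑_{ν=1}^s A_ν ⊗ B_ν` into `s` products of one-site operators at the
two ends of the edge `e`. -/
def SchmidtRankLE (e : Sym2 V) (s : ℕ) (A : Op V d) : Prop :=
  ∃ v w : V, e = s(v, w) ∧ ∃ a b : Fin s → Matrix (Fin d) (Fin d) ℂ,
    A = ∑ ν, siteTensor fun u => if u = v then a ν else if u = w then b ν else 1

variable (G)

/-- `ρ` is a PEPO on the graph `G` of bond dimension `D`:
`ρ = ∑_{α : E → {1,…,D}} ⨂_v X^v_{α(e) : e ∋ v}`. -/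
def IsPEPO (D : ℕ) (ρ : Op V d) : Prop :=
  ∃ X : (v : V) → ({e : G.edgeSet // v ∈ (e : Sym2 V)} → Fin D) → Matrix (Fin d) (Fin d) ℂ,
    ρ = ∑ α : G.edgeSet → Fin D, siteTensor fun v => X v fun e => α e.1

/-- The vector `Φ` is a PEPS on the graph `G` of bond dimension `D`. -/
def IsPEPS (D : ℕ) (Φ : (V → Fin d) → ℂ) : Prop :=
  ∃ T : (v : V) → ({e : G.edgeSet // v ∈ (e : Sym2 V)} → Fin D) → Fin d → ℂ,
    Φ = fun σ => ∑ α : G.edgeSet → Fin D, ∏ v, T v (fun e => α e.1) (σ v)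

variable {G}

/-- `Ψ` is a normalised ground state of `A`, with energy `E₀`, and every other energy level
(the spectrum on the orthogonal complement of `Ψ`) is at least `E₀ + Δ`. -/
def IsGappedGroundState (A : Op V d) (Ψ : (V → Fin d) → ℂ) (E₀ Δ : ℝ) : Prop :=
  star Ψ ⬝ᵥ Ψ = 1 ∧ A *ᵥ Ψ = (E₀ : ℂ) • Ψ ∧
    ∀ (φ : (V → Fin d) → ℂ) (E : ℝ), φ ≠ 0 → star Ψ ⬝ᵥ φ = 0 → A *ᵥ φ = (E : ℂ) • φ → E₀ + Δ ≤ E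

/-- The number of eigenvalues, counted with multiplicity, that are at most `E`. -/
def levelCount {A : Op V d} (hA : A.IsHermitian) (E : ℝ) : ℕ :=
  (Finset.univ.filter fun i => hA.eigenvalues i ≤ E).card

end

end GibbsPEPO

/-!
Write `A = e^{-βH/M}`, so that `e^{-βH} = A ^ M`. Hölder's inequality for Schatten norms with
`M = 2 ^ k` factors gives `‖∏ⱼ (Yⱼ A)‖₁ ≤ (∏ⱼ ‖Yⱼ‖) ‖A ^ M‖₁`, so a row of the Trotter product
has to be compared with `A` in operator norm only, where it is close to `A` for large `M`. The
tables with a column of more than `L` ones are removed by inclusion–exclusion over the set `S` of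
offending columns; weighting the ones of a column exponentially shows that the terms with a given
`S` have total trace norm of order at most `e^{(cβ - L)|S|} ‖e^{-βH}‖₁`. What is left is a PEPO: an
edge carries, for each of its two columns, the positions of the at most `L` ones together with the
Schmidt indices of the corresponding factors.

A ground state is reached at `β ~ log (N / ε)`: the bound on the number of levels dominates the
weight of the excited states by a geometric series, so a multiple of `e^{-βH}` is close to the
projection onto the ground state. Since the trace norm dominates the Hilbert–Schmidt norm, some
column of the PEPO, rescaled, is a PEPS close to the ground state.
-/

namespace GibbsPEPO

noncomputable section

section Schatten

open scoped ComplexOrder MatrixOrder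

variable {m n : Type*} [Fintype m] [Fintype n]

theorem re_trace_nonneg {X : Matrix n n ℂ} (hX : 0 ≤ X) : 0 ≤ X.trace.re :=
  (Complex.nonneg_iff.1 (Matrix.nonneg_iff_posSemidef.1 hX).trace_nonneg).1

theorem re_trace_conjTranspose_mul_self (X : Matrix m n ℂ) :
    (Xᴴ * X).trace.re = ∑ i, ∑ j, ‖X i j‖ ^ 2 := by
  simp only [Matrix.trace, Matrix.diag, Matrix.mul_apply, Matrix.conjTranspose_apply,
    Complex.re_sum]
  rw [Finset.sum_comm]
  refine Finset.sum_congr rfl fun i _ => Finset.sum_congr rfl fun j _ => ?_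
  rw [Complex.star_def, ← Complex.normSq_eq_conj_mul_self, Complex.ofReal_re,
    Complex.normSq_eq_norm_sq]

theorem re_trace_mul_nonneg {X Y : Matrix n n ℂ} (hX : 0 ≤ X) (hY : 0 ≤ Y) :
    0 ≤ (X * Y).trace.re := by
  classical
  obtain ⟨B, rfl⟩ := CStarAlgebra.nonneg_iff_eq_star_mul_self.1 hX
  rw [mul_assoc, Matrix.trace_mul_comm]
  exact re_trace_nonneg (star_right_conjugate_nonneg hY B)

variable [DecidableEq n]

theorem trace_mul_pow_comm [DecidableEq m] {R : Type*} [CommSemiring R] (X : Matrix m n R)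
    (Y : Matrix n m R) {k : ℕ} (hk : k ≠ 0) : ((X * Y) ^ k).trace = ((Y * X) ^ k).trace := by
  have hpow : ∀ k : ℕ, (X * Y) ^ (k + 1) = X * ((Y * X) ^ k * Y) := fun k => by
    induction k with
    | zero => simp
    | succ k ih => rw [pow_succ, ih, pow_succ]; simp only [Matrix.mul_assoc]
  obtain ⟨k, rfl⟩ := Nat.exists_eq_succ_of_ne_zero hk
  rw [Nat.succ_eq_add_one, hpow, Matrix.trace_mul_comm, pow_succ, Matrix.mul_assoc]

/-- The Schatten norm `(tr (X† X)^(p/2))^(1/p)` of order `p = 2^(k+1)`. Only these orders are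
needed, and for them `(X† X)^(p/2)` is an ordinary power. -/
def schattenNorm (k : ℕ) (X : Matrix m n ℂ) : ℝ :=
  ((Xᴴ * X) ^ 2 ^ k).trace.re ^ ((2 ^ (k + 1) : ℕ) : ℝ)⁻¹

theorem re_trace_conjTranspose_mul_self_pow_nonneg (X : Matrix m n ℂ) (k : ℕ) :
    0 ≤ ((Xᴴ * X) ^ k).trace.re :=
  re_trace_nonneg ((Matrix.posSemidef_conjTranspose_mul_self X).pow k).nonneg

theorem schattenNorm_nonneg (k : ℕ) (X : Matrix m n ℂ) : 0 ≤ schattenNorm k X :=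
  Real.rpow_nonneg (re_trace_conjTranspose_mul_self_pow_nonneg X _) _

theorem schattenNorm_pow (k : ℕ) (X : Matrix m n ℂ) :
    schattenNorm k X ^ 2 ^ (k + 1) = ((Xᴴ * X) ^ 2 ^ k).trace.re :=
  Real.rpow_inv_natCast_pow (re_trace_conjTranspose_mul_self_pow_nonneg X _) (by positivity)

theorem schattenNorm_pow_of_isHermitian {P : Matrix n n ℂ} (hP : P.IsHermitian) (k : ℕ) :
    schattenNorm k P ^ 2 ^ (k + 1) = (P ^ 2 ^ (k + 1)).trace.re := by
  rw [schattenNorm_pow, hP.eq, ← sq, ← pow_mul, pow_succ' 2 k]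

theorem schattenNorm_le_of_pow_le {k : ℕ} {X : Matrix m n ℂ} {r : ℝ} (hr : 0 ≤ r)
    (h : ((Xᴴ * X) ^ 2 ^ k).trace.re ≤ r ^ 2 ^ (k + 1)) : schattenNorm k X ≤ r :=
  le_of_pow_le_pow_left₀ (by positivity) hr ((schattenNorm_pow k X).trans_le h)

theorem schattenNorm_conjTranspose_mul_self (k : ℕ) (X : Matrix m n ℂ) :
    schattenNorm k (Xᴴ * X) = schattenNorm (k + 1) X ^ 2 := by
  rw [← pow_left_inj₀ (schattenNorm_nonneg _ _) (sq_nonneg _) (pow_ne_zero (k + 1) two_ne_zero),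
    schattenNorm_pow_of_isHermitian (Matrix.isHermitian_conjTranspose_mul_self X), ← pow_mul,
    ← pow_succ', schattenNorm_pow]

theorem schattenNorm_mul_conjTranspose_self [DecidableEq m] (k : ℕ) (X : Matrix m n ℂ) :
    schattenNorm k (X * Xᴴ) = schattenNorm (k + 1) X ^ 2 := by
  rw [← pow_left_inj₀ (schattenNorm_nonneg _ _) (sq_nonneg _) (pow_ne_zero (k + 1) two_ne_zero),
    schattenNorm_pow_of_isHermitian (Matrix.isHermitian_mul_conjTranspose_self X), ← pow_mul,
    ← pow_succ', schattenNorm_pow, trace_mul_pow_comm _ _ (by positivity)]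

theorem schattenNorm_zero_sq (X : Matrix m n ℂ) :
    schattenNorm 0 X ^ 2 = ∑ i, ∑ j, ‖X i j‖ ^ 2 := by
  simpa only [zero_add, pow_zero, pow_one, re_trace_conjTranspose_mul_self] using
    schattenNorm_pow 0 X

theorem norm_trace_mul_le_schattenNorm_zero [DecidableEq m] (X : Matrix m n ℂ)
    (Y : Matrix n m ℂ) : ‖(X * Y).trace‖ ≤ schattenNorm 0 X * schattenNorm 0 Y := by
  have hentries : ‖(X * Y).trace‖ ≤ ∑ p : m × n, ‖X p.1 p.2‖ * ‖Y p.2 p.1‖ := by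
    rw [Fintype.sum_prod_type]
    exact (norm_sum_le _ _).trans (Finset.sum_le_sum fun i _ => (norm_sum_le _ _).trans
      (Finset.sum_le_sum fun j _ => norm_mul_le _ _))
  refine le_of_pow_le_pow_left₀ two_ne_zero
    (mul_nonneg (schattenNorm_nonneg _ _) (schattenNorm_nonneg _ _)) ?_
  calc ‖(X * Y).trace‖ ^ 2 ≤ (∑ p : m × n, ‖X p.1 p.2‖ * ‖Y p.2 p.1‖) ^ 2 := by gcongr
    _ ≤ (∑ p : m × n, ‖X p.1 p.2‖ ^ 2) * ∑ p : m × n, ‖Y p.2 p.1‖ ^ 2 :=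
      Finset.sum_mul_sq_le_sq_mul_sq _ _ _
    _ = (schattenNorm 0 X * schattenNorm 0 Y) ^ 2 := by
      rw [mul_pow, schattenNorm_zero_sq, schattenNorm_zero_sq, Fintype.sum_prod_type,
        Fintype.sum_prod_type_right]

/-- Hölder's inequality for the trace of a product of `2^(k+1)` matrices, with the same Schatten
norm of order `2^(k+1)` on every factor. -/
def TraceHolder (n : Type*) [Fintype n] [DecidableEq n] (k : ℕ) : Prop :=
  ∀ l : List (Matrix n n ℂ), l.length = 2 ^ (k + 1) →
    ‖l.prod.trace‖ ≤ (l.map (schattenNorm k)).prod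

theorem TraceHolder.schattenNorm_mul_le {k : ℕ} (hk : TraceHolder n k) (X Y : Matrix n n ℂ) :
    schattenNorm k (X * Y) ≤ schattenNorm (k + 1) X * schattenNorm (k + 1) Y := by
  have hcycle : (((X * Y)ᴴ * (X * Y)) ^ 2 ^ k).trace = ((Xᴴ * X * (Y * Yᴴ)) ^ 2 ^ k).trace := by
    rw [Matrix.conjTranspose_mul, show Yᴴ * Xᴴ * (X * Y) = Yᴴ * (Xᴴ * X * Y) by
      simp only [mul_assoc], trace_mul_pow_comm _ _ (by positivity), mul_assoc]
  have halternating := hk (List.replicate (2 ^ k) [Xᴴ * X, Y * Yᴴ]).flatten (by simp [pow_succ])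
  rw [List.map_flatten, List.prod_flatten, List.prod_flatten] at halternating
  simp only [List.map_replicate, List.map_cons, List.map_nil, List.prod_replicate, List.prod_cons,
    List.prod_nil, mul_one, schattenNorm_conjTranspose_mul_self,
    schattenNorm_mul_conjTranspose_self] at halternating
  refine schattenNorm_le_of_pow_le
    (mul_nonneg (schattenNorm_nonneg _ _) (schattenNorm_nonneg _ _)) ?_
  calc (((X * Y)ᴴ * (X * Y)) ^ 2 ^ k).trace.re
      ≤ ‖((Xᴴ * X * (Y * Yᴴ)) ^ 2 ^ k).trace‖ := by rw [hcycle]; exact Complex.re_le_norm _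
    _ ≤ (schattenNorm (k + 1) X ^ 2 * schattenNorm (k + 1) Y ^ 2) ^ 2 ^ k := halternating
    _ = (schattenNorm (k + 1) X * schattenNorm (k + 1) Y) ^ 2 ^ (k + 1) := by
      rw [← mul_pow, ← pow_mul, ← pow_succ']

theorem prod_map_schattenNorm_nonneg (k : ℕ) (l : List (Matrix n n ℂ)) :
    0 ≤ (l.map (schattenNorm k)).prod :=
  List.prod_nonneg fun _ ha => by
    obtain ⟨X, -, rfl⟩ := List.mem_map.1 ha
    exact schattenNorm_nonneg k X

theorem TraceHolder.exists_paired_list {k : ℕ} (hk : TraceHolder n k) {m : ℕ}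
    {l : List (Matrix n n ℂ)} (hl : l.length = 2 * m) :
    ∃ l' : List (Matrix n n ℂ), l'.length = m ∧ l'.prod = l.prod ∧
      (l'.map (schattenNorm k)).prod ≤ (l.map (schattenNorm (k + 1))).prod := by
  induction m generalizing l with
  | zero =>
    obtain rfl : l = [] := List.length_eq_zero_iff.1 hl
    exact ⟨[], rfl, rfl, le_rfl⟩
  | succ m ih =>
    match l, hl with
    | X :: Y :: l, hl =>
      obtain ⟨l', hlength, hprod, hle⟩ := ih (l := l) (by simp only [List.length_cons] at hl; lia)
      refine ⟨(X * Y) :: l', by simp [hlength], by simp [hprod, mul_assoc], ?_⟩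
      simp only [List.map_cons, List.prod_cons, ← mul_assoc]
      exact mul_le_mul (hk.schattenNorm_mul_le X Y) hle (prod_map_schattenNorm_nonneg k l')
        (mul_nonneg (schattenNorm_nonneg _ _) (schattenNorm_nonneg _ _))

theorem traceHolder (k : ℕ) : TraceHolder n k := by
  induction k with
  | zero =>
    intro l hl
    match l, hl with
    | [X, Y], _ => simpa using norm_trace_mul_le_schattenNorm_zero X Y
  | succ k ih =>
    intro l hl
    obtain ⟨l', hlength, hprod, hle⟩ := ih.exists_paired_list (hl.trans (pow_succ' 2 (k + 1)))
    rw [← hprod]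
    exact (ih l' hlength).trans hle

theorem re_trace_pow_le_of_le {X Z : Matrix n n ℂ} (hX : 0 ≤ X) (hXZ : X ≤ Z) (k : ℕ) :
    (X ^ 2 ^ k).trace.re ≤ (Z ^ 2 ^ k).trace.re := by
  cases k with
  | zero => simpa [Matrix.trace_sub] using re_trace_nonneg (sub_nonneg.2 hXZ)
  | succ k =>
    have hXh : X.IsHermitian := (Matrix.nonneg_iff_posSemidef.1 hX).1
    have hZh : Z.IsHermitian := (Matrix.nonneg_iff_posSemidef.1 (hX.trans hXZ)).1
    obtain ⟨q, hq⟩ : ∃ q, 2 ^ (k + 1) = q + 1 :=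
      ⟨2 ^ (k + 1) - 1, (Nat.sub_add_cancel Nat.one_le_two_pow).symm⟩
    have hmono : (X ^ 2 ^ (k + 1)).trace.re ≤ (X ^ q * Z).trace.re := by
      have hXq : 0 ≤ X ^ q := ((Matrix.nonneg_iff_posSemidef.1 hX).pow q).nonneg
      simpa [hq, pow_succ, mul_sub, Matrix.trace_sub] using
        re_trace_mul_nonneg hXq (sub_nonneg.2 hXZ)
    have hholder : ‖(X ^ q * Z).trace‖ ≤ schattenNorm k X ^ q * schattenNorm k Z := by
      simpa using traceHolder k (List.replicate q X ++ [Z]) (by simp [hq])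
    rw [← schattenNorm_pow_of_isHermitian hXh] at hmono ⊢
    rw [← schattenNorm_pow_of_isHermitian hZh]
    have hpow : schattenNorm k X ^ q * schattenNorm k X ≤
        schattenNorm k X ^ q * schattenNorm k Z := by
      rw [← pow_succ, ← hq]
      exact hmono.trans ((Complex.re_le_norm _).trans hholder)
    refine pow_le_pow_left₀ (schattenNorm_nonneg k X) ?_ _
    rcases (schattenNorm_nonneg k X).eq_or_lt with h0 | hpos
    · exact h0 ▸ schattenNorm_nonneg k Z
    · exact le_of_mul_le_mul_left hpow (pow_pos hpos q)

theorem schattenNorm_mul_le_norm_mul (k : ℕ) (Y A : Matrix n n ℂ) :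
    schattenNorm k (Y * A) ≤ ‖Y‖ * schattenNorm k A := by
  have hle : (Y * A)ᴴ * (Y * A) ≤ ((‖Y‖ ^ 2 : ℝ) : ℂ) • (Aᴴ * A) := by
    have := star_left_conjugate_le_conjugate
      (CStarAlgebra.star_mul_le_algebraMap_norm_sq (a := Y)) A
    convert this using 1
    · simp only [Matrix.star_eq_conjTranspose, Matrix.conjTranspose_mul, mul_assoc]
    · rw [Algebra.algebraMap_eq_smul_one, mul_smul_comm, mul_one, smul_mul_assoc]
      rfl
  refine schattenNorm_le_of_pow_le (mul_nonneg (norm_nonneg _) (schattenNorm_nonneg _ _)) ?_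
  have hnonneg := (Matrix.posSemidef_conjTranspose_mul_self (Y * A)).nonneg
  refine (re_trace_pow_le_of_le hnonneg hle k).trans_eq ?_
  rw [smul_pow, Matrix.trace_smul, smul_eq_mul, ← Complex.ofReal_pow, Complex.re_ofReal_mul,
    mul_pow, schattenNorm_pow, ← pow_mul, ← pow_succ']

theorem norm_trace_prod_mul_le (k : ℕ) {A : Matrix n n ℂ} (hA : A.IsHermitian)
    (l : List (Matrix n n ℂ)) (hl : l.length = 2 ^ (k + 1)) :
    ‖(l.map (· * A)).prod.trace‖ ≤ (l.map norm).prod * (A ^ 2 ^ (k + 1)).trace.re := by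
  have hprod : ∀ l : List (Matrix n n ℂ), ((l.map (· * A)).map (schattenNorm k)).prod ≤
      (l.map norm).prod * schattenNorm k A ^ l.length := fun l => by
    induction l with
    | nil => simp
    | cons Y l ih =>
      simp only [List.map_cons, List.prod_cons, List.length_cons, pow_succ']
      refine (mul_le_mul (schattenNorm_mul_le_norm_mul k Y A) ih
        (prod_map_schattenNorm_nonneg k _) ?_).trans_eq (by ring)
      exact mul_nonneg (norm_nonneg _) (schattenNorm_nonneg _ _)
  rw [← schattenNorm_pow_of_isHermitian hA, ← hl]
  exact (traceHolder k _ (by simpa using hl)).trans (hprod l)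

end Schatten

section TraceNorm

variable {n : Type*} [Fintype n]

theorem dotProduct_star_self_eq_norm_sq (x : n → ℂ) :
    star x ⬝ᵥ x = ((‖WithLp.toLp 2 x‖ ^ 2 : ℝ) : ℂ) := by
  rw [dotProduct_comm, ← EuclideanSpace.inner_toLp_toLp, inner_self_eq_norm_sq_to_K]
  norm_cast

variable [DecidableEq n]

theorem norm_mulVec_eigenvectorBasis (A : Matrix n n ℂ) (i : n) :
    ‖WithLp.toLp 2 (A *ᵥ
      ((Matrix.isHermitian_conjTranspose_mul_self A).eigenvectorBasis i).ofLp)‖ =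
      √((Matrix.isHermitian_conjTranspose_mul_self A).eigenvalues i) := by
  rw [eq_comm, Real.sqrt_eq_iff_eq_sq (Matrix.eigenvalues_conjTranspose_mul_self_nonneg A i)
    (norm_nonneg _), Matrix.IsHermitian.eigenvalues_eq, ← Matrix.mulVec_mulVec,
    Matrix.dotProduct_mulVec, ← Matrix.star_mulVec, dotProduct_star_self_eq_norm_sq]
  exact Complex.ofReal_re _

theorem norm_trace_mul_le_traceNorm {X : Matrix n n ℂ} (hX : ‖X‖ ≤ 1) (A : Matrix n n ℂ) :
    ‖(X * A).trace‖ ≤ traceNorm A := by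
  set b := (Matrix.isHermitian_conjTranspose_mul_self A).eigenvectorBasis
  have htrace : (X * A).trace = ∑ i, inner ℂ (b i) (Matrix.toEuclideanLin (X * A) (b i)) := by
    rw [← LinearMap.trace_eq_sum_inner, Matrix.toEuclideanLin_eq_toLin_orthonormal,
      Matrix.trace_toLin_eq]
  rw [htrace, traceNorm]
  refine norm_sum_le_of_le _ fun i _ => ?_
  calc ‖inner ℂ (b i) (Matrix.toEuclideanLin (X * A) (b i))‖
      ≤ ‖Matrix.toEuclideanLin (X * A) (b i)‖ := by
        simpa using norm_inner_le_norm (𝕜 := ℂ) (b i) (Matrix.toEuclideanLin (X * A) (b i))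
    _ = ‖WithLp.toLp 2 (X *ᵥ (A *ᵥ (b i).ofLp))‖ := by rw [Matrix.mulVec_mulVec]; rfl
    _ ≤ ‖X‖ * ‖WithLp.toLp 2 (A *ᵥ (b i).ofLp)‖ :=
      Matrix.l2_opNorm_mulVec X (WithLp.toLp 2 (A *ᵥ (b i).ofLp))
    _ ≤ ‖WithLp.toLp 2 (A *ᵥ (b i).ofLp)‖ := mul_le_of_le_one_left (norm_nonneg _) hX
    _ = _ := norm_mulVec_eigenvectorBasis A i

theorem trace_conjStarAlgAut (u : unitary (Matrix n n ℂ)) (X : Matrix n n ℂ) :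
    (Unitary.conjStarAlgAut ℂ _ u X).trace = X.trace := by
  rw [Unitary.conjStarAlgAut_apply, Matrix.trace_mul_cycle, Unitary.coe_star_mul_self, one_mul]

theorem norm_conjStarAlgAut (u : unitary (Matrix n n ℂ)) (X : Matrix n n ℂ) :
    ‖Unitary.conjStarAlgAut ℂ _ u X‖ = ‖X‖ := by
  rw [Unitary.conjStarAlgAut_apply, ← Unitary.coe_star, CStarRing.norm_mul_coe_unitary,
    CStarRing.norm_coe_unitary_mul]

theorem exists_trace_mul_eq_traceNorm (A : Matrix n n ℂ) :
    ∃ U : Matrix n n ℂ, ‖U‖ ≤ 1 ∧ (U * A).trace = traceNorm A := by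
  set hA := Matrix.isHermitian_conjTranspose_mul_self A
  set s : n → ℝ := fun i => √(hA.eigenvalues i)
  set φ := Unitary.conjStarAlgAut ℂ (Matrix n n ℂ) hA.eigenvectorUnitary
  set W := φ (Matrix.diagonal fun i => ((s i)⁻¹ : ℂ))
  have hspec : Aᴴ * A = φ (Matrix.diagonal fun i => (s i * s i : ℂ)) := by
    conv_lhs => rw [hA.spectral_theorem]
    congr 2
    ext i
    rw [← Complex.ofReal_mul]
    exact congrArg Complex.ofReal
      (Real.mul_self_sqrt (Matrix.eigenvalues_conjTranspose_mul_self_nonneg A i)).symm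
  have hW : Wᴴ = W := by
    rw [← Matrix.star_eq_conjTranspose, ← map_star, Matrix.star_eq_conjTranspose,
      Matrix.diagonal_conjTranspose]
    congr 2
    ext i
    simp
  have hinv (i : n) : (s i : ℂ)⁻¹ * (s i * s i) = s i := by
    rcases eq_or_ne (s i : ℂ) 0 with h | h
    · simp [h]
    · field_simp
  refine ⟨W * Aᴴ, ?_, ?_⟩
  · have hsq : ‖W * Aᴴ‖ * ‖W * Aᴴ‖ ≤ 1 := by
      rw [← CStarRing.norm_self_mul_star, Matrix.star_eq_conjTranspose, Matrix.conjTranspose_mul,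
        hW, Matrix.conjTranspose_conjTranspose, mul_assoc, ← mul_assoc Aᴴ, hspec, ← map_mul,
        ← map_mul, norm_conjStarAlgAut, Matrix.diagonal_mul_diagonal, Matrix.diagonal_mul_diagonal,
        Matrix.l2_opNorm_diagonal]
      refine (pi_norm_le_iff_of_nonneg zero_le_one).2 fun i => ?_
      rw [← mul_assoc, hinv]
      rcases eq_or_ne (s i : ℂ) 0 with h | h <;> simp [h]
    exact abs_le_one_iff_mul_self_le_one.2 hsq |>.trans' (le_abs_self _)
  · rw [mul_assoc, hspec, ← map_mul, trace_conjStarAlgAut, Matrix.diagonal_mul_diagonal,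
      Matrix.trace_diagonal, traceNorm, Complex.ofReal_sum]
    exact Finset.sum_congr rfl fun i _ => hinv i

theorem traceNorm_le_of_forall {A : Matrix n n ℂ} {c : ℝ}
    (h : ∀ U : Matrix n n ℂ, ‖U‖ ≤ 1 → ‖(U * A).trace‖ ≤ c) : traceNorm A ≤ c := by
  obtain ⟨U, hU, hUA⟩ := exists_trace_mul_eq_traceNorm A
  have hc := h U hU
  rw [hUA, Complex.norm_real] at hc
  exact (le_abs_self _).trans hc

theorem traceNorm_nonneg (A : Matrix n n ℂ) : 0 ≤ traceNorm A :=
  Finset.sum_nonneg fun _ _ => Real.sqrt_nonneg _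

theorem traceNorm_zero : traceNorm (0 : Matrix n n ℂ) = 0 :=
  le_antisymm (traceNorm_le_of_forall fun U _ => by simp) (traceNorm_nonneg _)

theorem traceNorm_add_le (A B : Matrix n n ℂ) : traceNorm (A + B) ≤ traceNorm A + traceNorm B :=
  traceNorm_le_of_forall fun U hU => by
    rw [mul_add, Matrix.trace_add]
    exact norm_add_le_of_le (norm_trace_mul_le_traceNorm hU A) (norm_trace_mul_le_traceNorm hU B)

theorem traceNorm_smul (c : ℂ) (A : Matrix n n ℂ) : traceNorm (c • A) = ‖c‖ * traceNorm A := by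
  have hle : ∀ (c : ℂ) (A : Matrix n n ℂ), traceNorm (c • A) ≤ ‖c‖ * traceNorm A := fun c A =>
    traceNorm_le_of_forall fun U hU => by
      rw [Matrix.mul_smul, Matrix.trace_smul, norm_smul]
      gcongr
      exact norm_trace_mul_le_traceNorm hU A
  refine (hle c A).antisymm ?_
  rcases eq_or_ne c 0 with rfl | hc
  · rw [norm_zero, zero_mul]
    exact traceNorm_nonneg _
  · calc ‖c‖ * traceNorm A = ‖c‖ * traceNorm (c⁻¹ • c • A) := by rw [inv_smul_smul₀ hc]
      _ ≤ ‖c‖ * (‖c⁻¹‖ * traceNorm (c • A)) := by gcongr; exact hle _ _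
      _ = traceNorm (c • A) := by rw [norm_inv, mul_inv_cancel_left₀ (norm_ne_zero_iff.2 hc)]

theorem traceNorm_sub_le (A B : Matrix n n ℂ) : traceNorm (A - B) ≤ traceNorm A + traceNorm B := by
  have hneg : traceNorm (-B) = traceNorm B := by simpa using traceNorm_smul (-1) B
  rw [sub_eq_add_neg, ← hneg]
  exact traceNorm_add_le A (-B)

theorem traceNorm_sum_le {ι : Type*} (s : Finset ι) (f : ι → Matrix n n ℂ) :
    traceNorm (∑ i ∈ s, f i) ≤ ∑ i ∈ s, traceNorm (f i) :=
  Finset.le_sum_of_subadditive _ traceNorm_zero.le traceNorm_add_le s f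

theorem re_trace_le_traceNorm (A : Matrix n n ℂ) : A.trace.re ≤ traceNorm A := by
  have hone : ‖(1 : Matrix n n ℂ)‖ ≤ 1 := by
    rcases subsingleton_or_nontrivial (Matrix n n ℂ) with _ | _
    · simp [Subsingleton.elim (1 : Matrix n n ℂ) 0]
    · exact norm_one.le
  simpa using (Complex.re_le_norm _).trans (norm_trace_mul_le_traceNorm hone A)

theorem sum_norm_sq_le_traceNorm_sq (A : Matrix n n ℂ) :
    ∑ i, ∑ j, ‖A i j‖ ^ 2 ≤ traceNorm A ^ 2 := by
  set hA := Matrix.isHermitian_conjTranspose_mul_self A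
  calc ∑ i, ∑ j, ‖A i j‖ ^ 2 = ∑ i, hA.eigenvalues i := by
        rw [← re_trace_conjTranspose_mul_self, hA.trace_eq_sum_eigenvalues, Complex.re_sum]
        rfl
    _ = ∑ i, √(hA.eigenvalues i) ^ 2 := Finset.sum_congr rfl fun i _ =>
        (Real.sq_sqrt (Matrix.eigenvalues_conjTranspose_mul_self_nonneg A i)).symm
    _ ≤ traceNorm A ^ 2 := Finset.sum_sq_le_sq_sum_of_nonneg fun i _ => Real.sqrt_nonneg _

theorem traceNorm_prod_mul_le (k : ℕ) {A : Matrix n n ℂ} (hA : A.IsHermitian)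
    {l : List (Matrix n n ℂ)} (hl : l.length = 2 ^ (k + 1)) :
    traceNorm (l.map (· * A)).prod ≤ (l.map norm).prod * traceNorm (A ^ 2 ^ (k + 1)) := by
  match l, hl with
  | [], hl => exact absurd hl (by positivity)
  | Y :: l, hl =>
    have hnonneg : 0 ≤ (l.map norm).prod := List.prod_nonneg fun _ ha => by
      obtain ⟨Z, -, rfl⟩ := List.mem_map.1 ha
      exact norm_nonneg Z
    refine traceNorm_le_of_forall fun U hU => ?_
    calc ‖(U * (((Y :: l).map (· * A)).prod)).trace‖
        = ‖(((U * Y :: l).map (· * A)).prod).trace‖ := by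
          simp only [List.map_cons, List.prod_cons, mul_assoc]
      _ ≤ ‖U * Y‖ * (l.map norm).prod * (A ^ 2 ^ (k + 1)).trace.re :=
        norm_trace_prod_mul_le k hA (U * Y :: l) (by simpa using hl)
      _ ≤ ‖Y‖ * (l.map norm).prod * traceNorm (A ^ 2 ^ (k + 1)) := by
        have hUY : ‖U * Y‖ ≤ ‖Y‖ :=
          (norm_mul_le _ _).trans (mul_le_of_le_one_left (norm_nonneg _) hU)
        have hA' : 0 ≤ traceNorm (A ^ 2 ^ (k + 1)) := traceNorm_nonneg _
        exact mul_le_mul_of_nonneg (by gcongr) (re_trace_le_traceNorm _) (by positivity) hA'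

end TraceNorm

section Exponential

open NormedSpace (exp)

variable {𝔸 : Type*} [NormedRing 𝔸] [NormOneClass 𝔸] [NormedAlgebra ℝ 𝔸] [CompleteSpace 𝔸]

theorem norm_exp_sub_sum_le_exp_norm_sub_sum (a : 𝔸) (k : ℕ) :
    ‖exp a - ∑ i ∈ Finset.range k, (i.factorial : ℝ)⁻¹ • a ^ i‖ ≤
      Real.exp ‖a‖ - ∑ i ∈ Finset.range k, (i.factorial : ℝ)⁻¹ • ‖a‖ ^ i := by
  have ha := (hasSum_nat_add_iff' k).2 (NormedSpace.exp_series_hasSum_exp' (𝕂 := ℝ) a)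
  have hr := (hasSum_nat_add_iff' k).2 (NormedSpace.exp_series_hasSum_exp' (𝕂 := ℝ) ‖a‖)
  rw [← Real.exp_eq_exp_ℝ] at hr
  refine ha.norm_le_of_bounded hr fun i => ?_
  rw [norm_smul, norm_inv, RCLike.norm_natCast, smul_eq_mul]
  gcongr
  exact norm_pow_le a _

theorem norm_exp_le_exp_norm (a : 𝔸) : ‖exp a‖ ≤ Real.exp ‖a‖ := by
  simpa using norm_exp_sub_sum_le_exp_norm_sub_sum a 0

theorem norm_exp_sub_one_le_exp_norm_sub_one (a : 𝔸) : ‖exp a - 1‖ ≤ Real.exp ‖a‖ - 1 := by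
  simpa using norm_exp_sub_sum_le_exp_norm_sub_sum a 1

theorem norm_exp_sub_one_sub_le_exp_norm_sub_one_sub (a : 𝔸) :
    ‖exp a - 1 - a‖ ≤ Real.exp ‖a‖ - 1 - ‖a‖ := by
  simpa [Finset.sum_range_succ, sub_sub] using norm_exp_sub_sum_le_exp_norm_sub_sum a 2

theorem norm_exp_sub_one_le_norm_mul_exp (a : 𝔸) : ‖exp a - 1‖ ≤ ‖a‖ * Real.exp ‖a‖ := by
  have hinv : Real.exp ‖a‖ * Real.exp (-‖a‖) = 1 := by rw [← Real.exp_add, add_neg_cancel,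
    Real.exp_zero]
  have hneg : Real.exp ‖a‖ * (1 - ‖a‖) ≤ Real.exp ‖a‖ * Real.exp (-‖a‖) := by
    gcongr
    exact Real.one_sub_le_exp_neg _
  linarith [norm_exp_sub_one_le_exp_norm_sub_one a]

theorem norm_prod_exp_le (l : List 𝔸) :
    ‖(l.map exp).prod‖ ≤ Real.exp (l.map norm).sum := by
  induction l with
  | nil => simp
  | cons a l ih =>
    simp only [List.map_cons, List.prod_cons, List.sum_cons, Real.exp_add]
    exact norm_mul_le_of_le (norm_exp_le_exp_norm a) ih

theorem norm_prod_exp_sub_one_le (l : List 𝔸) :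
    ‖(l.map exp).prod - 1‖ ≤ Real.exp (l.map norm).sum - 1 := by
  induction l with
  | nil => simp
  | cons a l ih =>
    simp only [List.map_cons, List.prod_cons, List.sum_cons, Real.exp_add]
    set P := (l.map exp).prod
    calc ‖exp a * P - 1‖ = ‖(exp a - 1) * P + (P - 1)‖ := by congr 1; noncomm_ring
      _ ≤ (Real.exp ‖a‖ - 1) * Real.exp (l.map norm).sum + (Real.exp (l.map norm).sum - 1) :=
        norm_add_le_of_le
          (norm_mul_le_of_le (norm_exp_sub_one_le_exp_norm_sub_one a) (norm_prod_exp_le l)) ih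
      _ = Real.exp ‖a‖ * Real.exp (l.map norm).sum - 1 := by ring

theorem norm_prod_exp_sub_one_sub_sum_le (l : List 𝔸) :
    ‖(l.map exp).prod - 1 - l.sum‖ ≤ Real.exp (l.map norm).sum - 1 - (l.map norm).sum := by
  induction l with
  | nil => simp
  | cons a l ih =>
    simp only [List.map_cons, List.prod_cons, List.sum_cons, Real.exp_add]
    set P := (l.map exp).prod
    set r := (l.map norm).sum
    calc ‖exp a * P - 1 - (a + l.sum)‖
        = ‖(exp a - 1 - a) * P + a * (P - 1) + (P - 1 - l.sum)‖ := by congr 1; noncomm_ring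
      _ ≤ (Real.exp ‖a‖ - 1 - ‖a‖) * Real.exp r + ‖a‖ * (Real.exp r - 1) + (Real.exp r - 1 - r) :=
        norm_add_le_of_le (norm_add_le_of_le
          (norm_mul_le_of_le (norm_exp_sub_one_sub_le_exp_norm_sub_one_sub a) (norm_prod_exp_le l))
          (norm_mul_le_of_le le_rfl (norm_prod_exp_sub_one_le l))) ih
      _ = Real.exp ‖a‖ * Real.exp r - 1 - (‖a‖ + r) := by ring

theorem norm_prod_exp_sub_one_sub_sum_le_sq {l : List 𝔸} {c : ℝ} (hl : (l.map norm).sum ≤ c)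
    (hc : c ≤ 1) : ‖(l.map exp).prod - 1 - l.sum‖ ≤ c ^ 2 := by
  have hnonneg : 0 ≤ (l.map norm).sum := List.sum_nonneg fun _ hx => by
    obtain ⟨y, -, rfl⟩ := List.mem_map.1 hx
    exact norm_nonneg y
  have habs : |(l.map norm).sum| = (l.map norm).sum := abs_of_nonneg hnonneg
  calc ‖(l.map exp).prod - 1 - l.sum‖ ≤ Real.exp (l.map norm).sum - 1 - (l.map norm).sum :=
        norm_prod_exp_sub_one_sub_sum_le l
    _ ≤ |(l.map norm).sum| ^ 2 := (le_abs_self _).trans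
        (Real.norm_exp_sub_one_sub_id_le (by rw [Real.norm_eq_abs, habs]; exact hl.trans hc))
    _ ≤ c ^ 2 := by rw [habs]; gcongr

variable {m : ℕ} {a : Fin m → 𝔸}

theorem norm_prod_exp_compl_mul_exp_sub_le (ha : 2 * ∑ i, ‖a i‖ ≤ 1) (S : Finset (Fin m)) :
    ‖((List.finRange m).map fun i => if i ∈ S then 1 else exp (a i)).prod * exp (-∑ i, a i) -
      1 + ∑ i ∈ S, a i‖ ≤ (2 * ∑ i, ‖a i‖) ^ 2 := by
  set b : Fin m → 𝔸 := fun i => if i ∈ S then 0 else a i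
  set l := (List.finRange m).map b ++ [-∑ i, a i]
  have hprod : (l.map exp).prod = ((List.finRange m).map fun i =>
      if i ∈ S then 1 else exp (a i)).prod * exp (-∑ i, a i) := by
    have hb : (fun i => if i ∈ S then 1 else exp (a i)) = exp ∘ b := by
      funext i
      simp only [b, Function.comp_apply]
      split_ifs
      exacts [NormedSpace.exp_zero.symm, rfl]
    simp only [l, hb, List.map_append, List.prod_append, List.map_map, List.map_singleton,
      List.prod_singleton]
  have hsum : l.sum = -∑ i ∈ S, a i := by
    have hcompl : ∑ i, b i = ∑ i ∈ Sᶜ, a i := by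
      simp only [b, Finset.sum_ite, Finset.sum_const_zero, zero_add]
      congr 1
      ext i
      simp
    rw [List.sum_append, ← Fin.sum_univ_def, List.sum_singleton, hcompl,
      ← Finset.sum_add_sum_compl S a]
    abel
  have hnorm : (l.map norm).sum ≤ 2 * ∑ i, ‖a i‖ := by
    have hb : ∑ i, ‖b i‖ ≤ ∑ i, ‖a i‖ := Finset.sum_le_sum fun i _ => by
      simp only [b]
      split_ifs <;> simp
    rw [List.map_append, List.sum_append, List.map_map, ← Fin.sum_univ_def, List.map_singleton,
      List.sum_singleton, norm_neg]
    linarith [norm_sum_le Finset.univ a, show ∑ i, (norm ∘ b) i = ∑ i, ‖b i‖ from rfl]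
  rw [← hprod, show (l.map exp).prod - 1 + ∑ i ∈ S, a i = (l.map exp).prod - 1 - l.sum by
    rw [hsum, sub_neg_eq_add]]
  exact norm_prod_exp_sub_one_sub_sum_le_sq hnorm ha

/-- The factor contributed by column `i` of a row `u` of the Trotter expansion
`∏_i (1 + x_i)`, when the expansion is carried out in the columns of `S` only. -/
def rowFactor {R ι : Type*} [Semiring R] [DecidableEq ι] (x : ι → R) (S : Finset ι)
    (u : ι → Fin 2) (i : ι) : R :=
  if i ∈ S then x i ^ (u i : ℕ) else 1 + x i

theorem norm_prod_rowFactor_mul_exp_le_of_forall_eq_zero (ha : 2 * ∑ i, ‖a i‖ ≤ 1)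
    {S : Finset (Fin m)} {u : Fin m → Fin 2} (hu : ∀ i ∈ S, u i = 0) :
    ‖((List.finRange m).map (rowFactor (fun i => exp (a i) - 1) S u)).prod * exp (-∑ i, a i)‖ ≤
      1 + ∑ i ∈ S, ‖a i‖ + (2 * ∑ i, ‖a i‖) ^ 2 := by
  have hrow : rowFactor (fun i => exp (a i) - 1) S u =
      fun i => if i ∈ S then 1 else exp (a i) := by
    funext i
    simp only [rowFactor]
    split_ifs with hi
    · rw [hu i hi, Fin.val_zero, pow_zero]
    · exact add_sub_cancel _ _
  set Z := ((List.finRange m).map fun i => if i ∈ S then 1 else exp (a i)).prod *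
    exp (-∑ i, a i) with hZ
  rw [hrow, ← hZ]
  calc ‖Z‖ = ‖1 - ∑ i ∈ S, a i + (Z - 1 + ∑ i ∈ S, a i)‖ := by congr 1; abel
    _ ≤ 1 + ∑ i ∈ S, ‖a i‖ + (2 * ∑ i, ‖a i‖) ^ 2 :=
      norm_add_le_of_le (norm_sub_le_of_le norm_one.le (norm_sum_le _ _))
        (norm_prod_exp_compl_mul_exp_sub_le ha S)

theorem norm_rowFactor_exp_sub_one_le (S : Finset (Fin m)) (u : Fin m → Fin 2) (i : Fin m) :
    ‖rowFactor (fun i => exp (a i) - 1) S u i‖ ≤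
      Real.exp ‖a i‖ * if i ∈ S then ‖a i‖ ^ (u i : ℕ) else 1 := by
  simp only [rowFactor]
  split_ifs
  · rcases Fin.exists_fin_two.1 ⟨u i, rfl⟩ with h | h
    · simp [h]
    · simpa [h, mul_comm] using norm_exp_sub_one_le_norm_mul_exp (a i)
  · rw [add_sub_cancel, mul_one]
    exact norm_exp_le_exp_norm _

theorem norm_prod_rowFactor_le (S : Finset (Fin m)) (u : Fin m → Fin 2) :
    ‖((List.finRange m).map (rowFactor (fun i => exp (a i) - 1) S u)).prod‖ ≤
      Real.exp (∑ i, ‖a i‖) * ∏ i ∈ S, ‖a i‖ ^ (u i : ℕ) := by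
  refine (List.norm_prod_le _).trans ?_
  rw [List.map_map, ← Fin.prod_univ_def]
  refine (Finset.prod_le_prod (fun i _ => norm_nonneg _) fun i _ =>
    norm_rowFactor_exp_sub_one_le S u i).trans_eq ?_
  rw [Finset.prod_mul_distrib, Real.exp_sum, Finset.prod_ite_mem, Finset.univ_inter]

theorem norm_prod_rowFactor_mul_exp_le_of_exists_ne_zero (ha : 2 * ∑ i, ‖a i‖ ≤ 1)
    {S : Finset (Fin m)} {u : Fin m → Fin 2} (hu : ∃ i ∈ S, u i ≠ 0) :
    ‖((List.finRange m).map (rowFactor (fun i => exp (a i) - 1) S u)).prod * exp (-∑ i, a i)‖ ≤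
      ∏ i ∈ S, (3 * ‖a i‖) ^ (u i : ℕ) := by
  obtain ⟨i₀, hi₀, hne⟩ := hu
  have hthree : (3 : ℝ) ≤ ∏ i ∈ S, (3 : ℝ) ^ (u i : ℕ) := by
    rw [← Finset.mul_prod_erase S _ hi₀, show (u i₀ : ℕ) = 1 by lia, pow_one]
    exact le_mul_of_one_le_right (by norm_num)
      (Finset.one_le_prod fun i _ => one_le_pow₀ (by norm_num))
  have hexp : Real.exp (2 * ∑ i, ‖a i‖) ≤ 3 :=
    (Real.exp_le_exp.2 ha).trans (by linarith [Real.exp_one_lt_d9])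
  have hinv : ‖exp (-∑ i, a i)‖ ≤ Real.exp (∑ i, ‖a i‖) :=
    (norm_exp_le_exp_norm _).trans
      (Real.exp_le_exp.2 ((norm_neg _).trans_le (norm_sum_le _ _)))
  calc _ ≤ Real.exp (∑ i, ‖a i‖) * (∏ i ∈ S, ‖a i‖ ^ (u i : ℕ)) * Real.exp (∑ i, ‖a i‖) :=
        norm_mul_le_of_le (norm_prod_rowFactor_le S u) hinv
    _ = Real.exp (2 * ∑ i, ‖a i‖) * ∏ i ∈ S, ‖a i‖ ^ (u i : ℕ) := by
      rw [mul_right_comm, ← Real.exp_add, two_mul]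
    _ ≤ (∏ i ∈ S, (3 : ℝ) ^ (u i : ℕ)) * ∏ i ∈ S, ‖a i‖ ^ (u i : ℕ) := by
      gcongr
      exact hexp.trans hthree
    _ = ∏ i ∈ S, (3 * ‖a i‖) ^ (u i : ℕ) := by simp only [mul_pow, Finset.prod_mul_distrib]

theorem norm_prod_rowFactor_mul_exp_le (ha : 2 * ∑ i, ‖a i‖ ≤ 1) (S : Finset (Fin m))
    (u : Fin m → Fin 2) :
    ‖((List.finRange m).map (rowFactor (fun i => exp (a i) - 1) S u)).prod * exp (-∑ i, a i)‖ ≤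
      (1 + ∑ i ∈ S, ‖a i‖ + (2 * ∑ i, ‖a i‖) ^ 2) * ∏ i ∈ S, (3 * ‖a i‖) ^ (u i : ℕ) := by
  by_cases hu : ∀ i ∈ S, u i = 0
  · rw [Finset.prod_eq_one fun i hi => by simp [hu i hi], mul_one]
    exact norm_prod_rowFactor_mul_exp_le_of_forall_eq_zero ha hu
  · push Not at hu
    have hnonneg : 0 ≤ ∑ i ∈ S, ‖a i‖ := by positivity
    refine (norm_prod_rowFactor_mul_exp_le_of_exists_ne_zero ha hu).trans
      (le_mul_of_one_le_left (by positivity) ?_)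
    nlinarith [sq_nonneg (2 * ∑ i, ‖a i‖)]

end Exponential

section Expansion

variable {M m : ℕ}

theorem prod_finRange_sum {R κ : Type*} [Semiring R] (s : Fin m → Finset κ) (f : Fin m → κ → R) :
    ((List.finRange m).map fun i => ∑ c ∈ s i, f i c).prod =
      ∑ r ∈ Fintype.piFinset s, ((List.finRange m).map fun i => f i (r i)).prod := by
  simpa only [MultilinearMap.mkPiAlgebraFin_apply, List.ofFn_eq_map] using
    (MultilinearMap.mkPiAlgebraFin ℕ m R).map_sum_finset f s

/-- The summand `∏_j ∏_i x_i ^ t_{ji}` of the expanded Trotter product `(∏_i (1 + x_i))^M`. -/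
def tableProd {R : Type*} [Semiring R] (x : Fin m → R) (t : Fin M → Fin m → Fin 2) : R :=
  ((List.finRange M).map fun j => ((List.finRange m).map fun i => x i ^ (t j i : ℕ)).prod).prod

/-- The Trotter product expanded in the columns of `S` only, where the table `u` prescribes the
exponents; its rows are the products of the `rowFactor`s. -/
def partialProd {R : Type*} [Semiring R] (x : Fin m → R) (S : Finset (Fin m))
    (u : Fin M → Fin m → Fin 2) : R :=
  ((List.finRange M).map fun j => ((List.finRange m).map (rowFactor x S (u j))).prod).prod

/-- The tables that vanish outside the columns of `S`: they stand for the tables with column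
set `S`. -/
def tablesOn (M : ℕ) (S : Finset (Fin m)) : Finset (Fin M → Fin m → Fin 2) :=
  Fintype.piFinset fun _ => Fintype.piFinset fun i => if i ∈ S then Finset.univ else {0}

/-- The tables with column set `S` all of whose columns have more than `L` ones. -/
def heavyTablesOn (M L : ℕ) (S : Finset (Fin m)) : Finset (Fin M → Fin m → Fin 2) :=
  {u ∈ tablesOn M S | ∀ i ∈ S, L < ∑ j, (u j i : ℕ)}

/-- The restriction of a table to the columns of `S`, in the encoding of `tablesOn`. -/
def restrictColumns (S : Finset (Fin m)) (t : Fin M → Fin m → Fin 2) : Fin M → Fin m → Fin 2 :=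
  fun j i => if i ∈ S then t j i else 0

theorem mem_tablesOn {S : Finset (Fin m)} {u : Fin M → Fin m → Fin 2} :
    u ∈ tablesOn M S ↔ ∀ j, ∀ i ∉ S, u j i = 0 := by
  simp only [tablesOn, Fintype.mem_piFinset]
  refine forall₂_congr fun j i => ?_
  split_ifs with hi <;> simp [hi]

theorem restrictColumns_mem_tablesOn (S : Finset (Fin m)) (t : Fin M → Fin m → Fin 2) :
    restrictColumns S t ∈ tablesOn M S :=
  mem_tablesOn.2 fun _ _ hi => if_neg hi

theorem restrictColumns_eq_iff {S : Finset (Fin m)} {t u : Fin M → Fin m → Fin 2}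
    (hu : u ∈ tablesOn M S) : restrictColumns S t = u ↔ ∀ j, ∀ i ∈ S, t j i = u j i := by
  simp only [funext_iff, restrictColumns]
  refine forall₂_congr fun j i => ?_
  split_ifs with hi
  · simp [hi]
  · simp [hi, mem_tablesOn.1 hu j i hi]

theorem sum_tableProd_restrictColumns_eq {R : Type*} [Semiring R] (x : Fin m → R)
    {S : Finset (Fin m)} {u : Fin M → Fin m → Fin 2} (hu : u ∈ tablesOn M S) :
    ∑ t with restrictColumns S t = u, tableProd x t = partialProd x S u := by
  set choices : Fin M → Fin m → Finset (Fin 2) := fun j i =>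
    if i ∈ S then {u j i} else Finset.univ
  have hfiber : Finset.univ.filter (fun t => restrictColumns S t = u) =
      Fintype.piFinset fun j => Fintype.piFinset (choices j) := by
    ext t
    simp only [Finset.mem_filter, Finset.mem_univ, true_and, restrictColumns_eq_iff hu,
      Fintype.mem_piFinset]
    refine forall₂_congr fun j i => ?_
    simp only [choices]
    split_ifs with hi <;> simp [hi]
  have hfactor : ∀ j i, rowFactor x S (u j) i = ∑ c ∈ choices j i, x i ^ (c : ℕ) := fun j i => by
    simp only [rowFactor, choices]
    split_ifs <;> simp [Fin.sum_univ_two]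
  simp only [hfiber, tableProd, partialProd, funext (hfactor _), prod_finRange_sum]

theorem sum_tableProd_of_heavy {R : Type*} [Semiring R] (x : Fin m → R) (S : Finset (Fin m))
    (L : ℕ) :
    ∑ t : Fin M → Fin m → Fin 2 with ∀ i ∈ S, L < ∑ j, (t j i : ℕ), tableProd x t =
      ∑ u ∈ heavyTablesOn M L S, partialProd x S u := by
  have hheavy : ∀ t : Fin M → Fin m → Fin 2, (∀ i ∈ S, L < ∑ j, (t j i : ℕ)) ↔
      restrictColumns S t ∈ heavyTablesOn M L S := fun t => by
    simp only [heavyTablesOn, Finset.mem_filter, restrictColumns_mem_tablesOn, true_and]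
    exact forall₂_congr fun i hi => by simp only [restrictColumns, if_pos hi]
  simp only [hheavy]
  rw [← Finset.sum_fiberwise_of_maps_to (t := heavyTablesOn M L S) (g := restrictColumns S)
    fun t ht => (Finset.mem_filter.1 ht).2]
  refine Finset.sum_congr rfl fun u hu => ?_
  rw [← sum_tableProd_restrictColumns_eq x (Finset.mem_filter.1 hu).1, Finset.filter_filter]
  refine Finset.sum_congr (Finset.filter_congr fun t _ => ?_) fun _ _ => rfl
  exact and_iff_right_of_imp fun h => h.symm ▸ hu

theorem sum_tableProd_of_light {R : Type*} [Ring R] (x : Fin m → R) (L : ℕ) :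
    ∑ t : Fin M → Fin m → Fin 2 with ∀ i, ∑ j, (t j i : ℕ) ≤ L, tableProd x t =
      ∑ S : Finset (Fin m), (-1 : ℤ) ^ S.card •
        ∑ u ∈ heavyTablesOn M L S, partialProd x S u := by
  have hie := Finset.inclusion_exclusion_sum_inf_compl (Finset.univ : Finset (Fin m))
    (fun i => {t : Fin M → Fin m → Fin 2 | L < ∑ j, (t j i : ℕ)}) (tableProd x)
  have hheavy : ∀ S : Finset (Fin m),
      S.inf (fun i => ({t | L < ∑ j, (t j i : ℕ)} : Finset (Fin M → Fin m → Fin 2))) =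
        ({t | ∀ i ∈ S, L < ∑ j, (t j i : ℕ)} : Finset (Fin M → Fin m → Fin 2)) := fun S => by
    ext t
    simp [Finset.mem_inf]
  have hlight : Finset.univ.inf
      (fun i => ({t | L < ∑ j, (t j i : ℕ)} : Finset (Fin M → Fin m → Fin 2))ᶜ) =
        ({t | ∀ i, ∑ j, (t j i : ℕ) ≤ L} : Finset (Fin M → Fin m → Fin 2)) := by
    ext t
    simp [Finset.mem_inf]
  simpa only [hheavy, hlight, sum_tableProd_of_heavy, Finset.powerset_univ] using hie

theorem sum_heavyTablesOn_empty {R : Type*} [Semiring R] (x : Fin m → R) (M L : ℕ) :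
    ∑ u ∈ heavyTablesOn M L ∅, partialProd x ∅ u =
      ((List.finRange m).map fun i => 1 + x i).prod ^ M := by
  have htables : heavyTablesOn M L (∅ : Finset (Fin m)) = {fun _ _ => 0} := by
    ext u
    simp [heavyTablesOn, tablesOn, funext_iff]
  have hrow : rowFactor x ∅ (fun _ => 0) = fun i => 1 + x i := by
    funext i
    simp [rowFactor]
  simp [htables, partialProd, hrow]

theorem sum_tablesOn_prod {R : Type*} [CommSemiring R] (S : Finset (Fin m)) (y : R) :
    ∑ u ∈ tablesOn M S, ∏ j, ∏ i ∈ S, y ^ (u j i : ℕ) = (1 + y) ^ (M * S.card) := by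
  have hrow : ∑ v ∈ Fintype.piFinset (fun i => if i ∈ S then (Finset.univ : Finset (Fin 2))
      else {0}), ∏ i ∈ S, y ^ (v i : ℕ) = (1 + y) ^ S.card := by
    calc _ = ∏ i, ∑ c ∈ if i ∈ S then (Finset.univ : Finset (Fin 2)) else {0},
          if i ∈ S then y ^ (c : ℕ) else 1 := by
          simp only [Finset.prod_univ_sum, Finset.prod_ite_mem, Finset.univ_inter]
      _ = ∏ i, if i ∈ S then 1 + y else 1 := Finset.prod_congr rfl fun i _ => by
          split_ifs <;> simp [Fin.sum_univ_two]
      _ = (1 + y) ^ S.card := by simp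
  rw [tablesOn, ← Finset.prod_univ_sum (fun _ : Fin M => Fintype.piFinset fun i =>
    if i ∈ S then (Finset.univ : Finset (Fin 2)) else {0}) (fun _ v => ∏ i ∈ S, y ^ (v i : ℕ)),
    hrow, Finset.prod_const, Finset.card_univ, Fintype.card_fin, ← pow_mul, mul_comm]

theorem pow_sub_pow_eq_sum {R : Type*} [Ring R] (a b : R) (M : ℕ) :
    a ^ M - b ^ M = ∑ j ∈ Finset.range M, a ^ j * (a - b) * b ^ (M - 1 - j) := by
  have hterm : ∀ j ∈ Finset.range M, a ^ j * (a - b) * b ^ (M - 1 - j) =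
      a ^ (j + 1) * b ^ (M - (j + 1)) - a ^ j * b ^ (M - j) := fun j hj => by
    obtain ⟨k, rfl⟩ := Nat.exists_eq_add_of_lt (Finset.mem_range.1 hj)
    rw [show j + k + 1 - 1 - j = k by lia, show j + k + 1 - (j + 1) = k by lia,
      show j + k + 1 - j = k + 1 by lia, pow_succ a, pow_succ' b]
    noncomm_ring
  rw [Finset.sum_congr rfl hterm, Finset.sum_range_sub fun j => a ^ j * b ^ (M - j)]
  simp

end Expansion

section TrotterError

open NormedSpace (exp)

theorem prod_le_exp_mul_prod_of_mem_heavyTablesOn {M m L : ℕ} {S : Finset (Fin m)}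
    {u : Fin M → Fin m → Fin 2} (hu : u ∈ heavyTablesOn M L S) {y : ℝ} (hy : 0 ≤ y) :
    ∏ j, ∏ i ∈ S, y ^ (u j i : ℕ) ≤
      Real.exp (-L) ^ S.card * ∏ j, ∏ i ∈ S, (Real.exp 1 * y) ^ (u j i : ℕ) := by
  have hcol : 1 ≤ Real.exp (-L) ^ S.card * ∏ j, ∏ i ∈ S, Real.exp 1 ^ (u j i : ℕ) := by
    rw [Finset.prod_comm, ← Finset.prod_const, ← Finset.prod_mul_distrib]
    refine Finset.one_le_prod fun i hi => ?_
    have hL : (L : ℝ) ≤ (∑ j, (u j i : ℕ) : ℕ) :=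
      mod_cast ((Finset.mem_filter.1 hu).2 i hi).le
    rw [Finset.prod_pow_eq_pow_sum, Real.exp_one_pow, ← Real.exp_add]
    exact Real.one_le_exp (by linarith)
  simp only [mul_pow, Finset.prod_mul_distrib] at hcol ⊢
  rw [← mul_assoc]
  exact le_mul_of_one_le_left (Finset.prod_nonneg fun j _ =>
    Finset.prod_nonneg fun i _ => pow_nonneg hy _) hcol

theorem sum_heavyTablesOn_prod_le (M L : ℕ) {m : ℕ} (S : Finset (Fin m)) {y : ℝ} (hy : 0 ≤ y) :
    ∑ u ∈ heavyTablesOn M L S, ∏ j, ∏ i ∈ S, y ^ (u j i : ℕ) ≤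
      Real.exp (3 * y * M - L) ^ S.card := by
  have hone : 1 + Real.exp 1 * y ≤ Real.exp (3 * y) := by
    nlinarith [Real.add_one_le_exp (3 * y), Real.exp_one_lt_d9]
  calc _ ≤ ∑ u ∈ heavyTablesOn M L S,
        Real.exp (-L) ^ S.card * ∏ j, ∏ i ∈ S, (Real.exp 1 * y) ^ (u j i : ℕ) :=
        Finset.sum_le_sum fun u hu => prod_le_exp_mul_prod_of_mem_heavyTablesOn hu hy
    _ ≤ Real.exp (-L) ^ S.card *
        ∑ u ∈ tablesOn M S, ∏ j, ∏ i ∈ S, (Real.exp 1 * y) ^ (u j i : ℕ) := by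
      rw [← Finset.mul_sum]
      gcongr
      exact Finset.filter_subset _ _
    _ ≤ Real.exp (-L) ^ S.card * Real.exp (3 * y) ^ (M * S.card) := by
      rw [sum_tablesOn_prod]
      gcongr
    _ = Real.exp (3 * y * M - L) ^ S.card := by
      rw [pow_mul, ← mul_pow, ← Real.exp_nat_mul, ← Real.exp_add]
      ring_nf

variable {n : Type*} [Fintype n] [DecidableEq n]

theorem exp_neg_mul_exp (A : Matrix n n ℂ) : exp (-A) * exp A = 1 := by
  rw [← Matrix.exp_add_of_commute _ _ (Commute.neg_left (Commute.refl A)), neg_add_cancel,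
    NormedSpace.exp_zero]

theorem traceNorm_prod_le {A : Matrix n n ℂ} (hA : A.IsHermitian) {k : ℕ}
    {l : List (Matrix n n ℂ)} (hl : l.length = 2 ^ (k + 1)) :
    traceNorm l.prod ≤
      (l.map fun R => ‖R * exp (-A)‖).prod * traceNorm (exp A ^ 2 ^ (k + 1)) := by
  simpa only [List.map_map, Function.comp_def, mul_assoc, exp_neg_mul_exp, mul_one, List.map_id',
    List.length_map] using
    traceNorm_prod_mul_le k hA.exp (l := l.map (· * exp (-A))) (by rwa [List.length_map])

variable [Nonempty n]

theorem traceNorm_pow_sub_mul_pow_le {A : Matrix n n ℂ} (hA : A.IsHermitian) {k M : ℕ}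
    (hM : M = 2 ^ (k + 1)) {Y : Matrix n n ℂ} {η : ℝ} (hY : ‖1 - Y‖ ≤ η) :
    traceNorm (A ^ M - (Y * A) ^ M) ≤ M * η * Real.exp (M * η) * traceNorm (A ^ M) := by
  have hη : 0 ≤ η := (norm_nonneg _).trans hY
  have hY_exp : ‖Y‖ ≤ Real.exp η := by
    linarith [Real.add_one_le_exp η, norm_le_norm_add_norm_sub' Y 1, norm_sub_rev Y 1,
      norm_one (α := Matrix n n ℂ)]
  have hterm : ∀ j ∈ Finset.range M, traceNorm (A ^ j * (A - Y * A) * (Y * A) ^ (M - 1 - j)) ≤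
      η * Real.exp (M * η) * traceNorm (A ^ M) := fun j hj => by
    have hj : j < M := Finset.mem_range.1 hj
    have h := traceNorm_prod_mul_le k hA
      (l := List.replicate j 1 ++ [1 - Y] ++ List.replicate (M - 1 - j) Y) (by simp; lia)
    simp only [List.map_append, List.map_replicate, List.prod_append, List.prod_replicate,
      List.map_singleton, List.prod_singleton, one_mul, sub_mul, ← hM, norm_one, one_pow] at h
    refine h.trans ?_
    gcongr
    · exact traceNorm_nonneg _
    · calc ‖Y‖ ^ (M - 1 - j) ≤ Real.exp η ^ (M - 1 - j) := by gcongr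
        _ ≤ Real.exp η ^ M := pow_le_pow_right₀ (Real.one_le_exp hη) (by lia)
        _ = Real.exp (M * η) := (Real.exp_nat_mul _ _).symm
  rw [pow_sub_pow_eq_sum]
  refine (traceNorm_sum_le _ _).trans ((Finset.sum_le_sum hterm).trans_eq ?_)
  rw [Finset.sum_const, Finset.card_range, nsmul_eq_mul]
  ring

variable {m : ℕ} {a : Fin m → Matrix n n ℂ} {δ : ℝ}

theorem traceNorm_partialProd_le (hsum : (∑ i, a i).IsHermitian) (ha : ∀ i, ‖a i‖ ≤ δ)
    (hδ₀ : 0 ≤ δ) (hδ : 2 * (m * δ) ≤ 1) {k M : ℕ} (hM : M = 2 ^ (k + 1)) (S : Finset (Fin m))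
    (u : Fin M → Fin m → Fin 2) :
    traceNorm (partialProd (fun i => exp (a i) - 1) S u) ≤
      (1 + S.card * δ + (2 * (m * δ)) ^ 2) ^ M * (∏ j, ∏ i ∈ S, (3 * δ) ^ (u j i : ℕ)) *
        traceNorm (exp (∑ i, a i) ^ M) := by
  have hnorm : ∑ i, ‖a i‖ ≤ m * δ := by
    simpa using Finset.sum_le_card_nsmul Finset.univ _ δ fun i _ => ha i
  have hnormS : ∑ i ∈ S, ‖a i‖ ≤ S.card * δ := by
    simpa using Finset.sum_le_card_nsmul S _ δ fun i _ => ha i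
  have hrow : ∀ j, ‖((List.finRange m).map (rowFactor (fun i => exp (a i) - 1) S (u j))).prod *
      exp (-∑ i, a i)‖ ≤
        (1 + S.card * δ + (2 * (m * δ)) ^ 2) * ∏ i ∈ S, (3 * δ) ^ (u j i : ℕ) := fun j =>
    (norm_prod_rowFactor_mul_exp_le (by linarith) S (u j)).trans (by gcongr; exact ha _)
  have h := traceNorm_prod_le hsum (k := k) (l := (List.finRange M).map fun j =>
    ((List.finRange m).map (rowFactor (fun i => exp (a i) - 1) S (u j))).prod) (by simpa)
  rw [List.map_map, ← Fin.prod_univ_def, ← hM] at h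
  refine h.trans (mul_le_mul_of_nonneg_right ?_ (traceNorm_nonneg _))
  refine (Finset.prod_le_prod (fun j _ => norm_nonneg _) fun j _ => hrow j).trans_eq ?_
  rw [Finset.prod_mul_distrib, Finset.prod_const, Finset.card_univ, Fintype.card_fin]

theorem traceNorm_sum_heavyTablesOn_le (hsum : (∑ i, a i).IsHermitian) (ha : ∀ i, ‖a i‖ ≤ δ)
    (hδ₀ : 0 ≤ δ) (hδ : 2 * (m * δ) ≤ 1) {k M : ℕ} (hM : M = 2 ^ (k + 1)) (L : ℕ)
    (S : Finset (Fin m)) :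
    traceNorm (∑ u ∈ heavyTablesOn M L S, partialProd (fun i => exp (a i) - 1) S u) ≤
      Real.exp (M * (2 * (m * δ)) ^ 2) * Real.exp (10 * (M * δ) - L) ^ S.card *
        traceNorm (exp (∑ i, a i) ^ M) := by
  set B := 1 + S.card * δ + (2 * (m * δ)) ^ 2
  set T := traceNorm (exp (∑ i, a i) ^ M)
  have hT : 0 ≤ T := traceNorm_nonneg _
  have hB : B ^ M ≤ Real.exp (M * (2 * (m * δ)) ^ 2) * Real.exp (M * δ) ^ S.card := by
    rw [← Real.exp_nat_mul (M * δ), ← Real.exp_add,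
      show M * (2 * (m * δ)) ^ 2 + S.card * (M * δ) = M * (S.card * δ + (2 * (m * δ)) ^ 2) by ring,
      Real.exp_nat_mul]
    gcongr
    linarith [Real.add_one_le_exp (S.card * δ + (2 * (m * δ)) ^ 2)]
  calc _ ≤ ∑ u ∈ heavyTablesOn M L S, B ^ M * (∏ j, ∏ i ∈ S, (3 * δ) ^ (u j i : ℕ)) * T :=
        (traceNorm_sum_le _ _).trans (Finset.sum_le_sum fun u _ =>
          traceNorm_partialProd_le hsum ha hδ₀ hδ hM S u)
    _ = B ^ M * (∑ u ∈ heavyTablesOn M L S, ∏ j, ∏ i ∈ S, (3 * δ) ^ (u j i : ℕ)) * T := by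
      rw [Finset.mul_sum, Finset.sum_mul]
    _ ≤ (Real.exp (M * (2 * (m * δ)) ^ 2) * Real.exp (M * δ) ^ S.card) *
        Real.exp (3 * (3 * δ) * M - L) ^ S.card * T := by
      gcongr
      exact sum_heavyTablesOn_prod_le M L S (by positivity)
    _ = Real.exp (M * (2 * (m * δ)) ^ 2) * Real.exp (10 * (M * δ) - L) ^ S.card * T := by
      rw [mul_assoc (Real.exp _), ← mul_pow, ← Real.exp_add]
      ring_nf

theorem traceNorm_exp_pow_sub_pow_prod_exp_le (hsum : (∑ i, a i).IsHermitian)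
    (ha : ∀ i, ‖a i‖ ≤ δ) (hδ : 2 * (m * δ) ≤ 1) {k M : ℕ} (hM : M = 2 ^ (k + 1)) :
    traceNorm (exp (∑ i, a i) ^ M - ((List.finRange m).map fun i => exp (a i)).prod ^ M) ≤
      M * (2 * (m * δ)) ^ 2 * Real.exp (M * (2 * (m * δ)) ^ 2) *
        traceNorm (exp (∑ i, a i) ^ M) := by
  set R := ((List.finRange m).map fun i => exp (a i)).prod
  have hnorm : ∑ i, ‖a i‖ ≤ m * δ := by
    simpa using Finset.sum_le_card_nsmul Finset.univ _ δ fun i _ => ha i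
  have hY : ‖1 - R * exp (-∑ i, a i)‖ ≤ (2 * (m * δ)) ^ 2 := by
    have := norm_prod_exp_compl_mul_exp_sub_le (a := a) (by linarith) ∅
    simp only [Finset.notMem_empty, if_false, Finset.sum_empty, add_zero] at this
    rw [norm_sub_rev]
    exact this.trans (by gcongr)
  simpa only [mul_assoc R, exp_neg_mul_exp, mul_one] using
    traceNorm_pow_sub_mul_pow_le hsum.exp hM hY

theorem traceNorm_sum_erase_empty_le (hsum : (∑ i, a i).IsHermitian) (ha : ∀ i, ‖a i‖ ≤ δ)
    (hδ₀ : 0 ≤ δ) (hδ : 2 * (m * δ) ≤ 1) {k M : ℕ} (hM : M = 2 ^ (k + 1)) (L : ℕ) :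
    traceNorm (∑ S ∈ Finset.univ.erase (∅ : Finset (Fin m)), (-1 : ℤ) ^ S.card •
        ∑ u ∈ heavyTablesOn M L S, partialProd (fun i => exp (a i) - 1) S u) ≤
      Real.exp (M * (2 * (m * δ)) ^ 2) * (Real.exp (m * Real.exp (10 * (M * δ) - L)) - 1) *
        traceNorm (exp (∑ i, a i) ^ M) := by
  set q := Real.exp (10 * (M * δ) - L)
  have hsigned : ∀ S : Finset (Fin m), traceNorm ((-1 : ℤ) ^ S.card •
      ∑ u ∈ heavyTablesOn M L S, partialProd (fun i => exp (a i) - 1) S u) ≤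
        Real.exp (M * (2 * (m * δ)) ^ 2) * q ^ S.card * traceNorm (exp (∑ i, a i) ^ M) :=
    fun S => by
      rw [← Int.cast_smul_eq_zsmul ℂ, traceNorm_smul]
      simpa using traceNorm_sum_heavyTablesOn_le hsum ha hδ₀ hδ hM L S
  have hpow : ∑ S ∈ Finset.univ.erase (∅ : Finset (Fin m)), q ^ S.card = (1 + q) ^ m - 1 := by
    have := Fintype.sum_pow_mul_eq_add_pow (Fin m) q 1
    simp only [one_pow, mul_one, Fintype.card_fin] at this
    rw [add_comm 1 q, ← this, Finset.sum_erase_eq_sub (Finset.mem_univ _), Finset.card_empty,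
      pow_zero]
  have hexp : (1 + q) ^ m ≤ Real.exp (m * q) := by
    rw [Real.exp_nat_mul, add_comm]
    gcongr
    exact Real.add_one_le_exp q
  refine (traceNorm_sum_le _ _).trans ((Finset.sum_le_sum fun S _ => hsigned S).trans ?_)
  rw [← Finset.sum_mul, ← Finset.mul_sum, hpow]
  gcongr
  exact traceNorm_nonneg _

theorem traceNorm_exp_pow_sub_sum_light_le (hsum : (∑ i, a i).IsHermitian)
    (ha : ∀ i, ‖a i‖ ≤ δ) (hδ₀ : 0 ≤ δ) (hδ : 2 * (m * δ) ≤ 1) {k M : ℕ} (hM : M = 2 ^ (k + 1))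
    {L : ℕ} {ε : ℝ} (hε : ε ≤ 1) (hstep : M * (2 * (m * δ)) ^ 2 ≤ ε / 8)
    (hcol : m * Real.exp (10 * (M * δ) - L) ≤ ε / 8) :
    traceNorm (exp (∑ i, a i) ^ M -
      ∑ u : Fin M → Fin m → Fin 2 with ∀ i, ∑ j, (u j i : ℕ) ≤ L,
        tableProd (fun i => exp (a i) - 1) u) ≤ ε * traceNorm (exp (∑ i, a i) ^ M) := by
  set η := M * (2 * (m * δ)) ^ 2
  set q := m * Real.exp (10 * (M * δ) - L)
  have hη : 0 ≤ η := by positivity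
  have hq : 0 ≤ q := by positivity
  have hexp : ∀ y : ℝ, 0 ≤ y → y ≤ ε / 8 → Real.exp y ≤ 1 + 2 * y := fun y hy hyε => by
    have := Real.norm_exp_sub_one_sub_id_le (x := y) (by rw [Real.norm_of_nonneg hy]; linarith)
    rw [Real.norm_of_nonneg hy, Real.norm_eq_abs, abs_le] at this
    nlinarith
  rw [sum_tableProd_of_light, ← Finset.add_sum_erase _ _ (Finset.mem_univ (∅ : Finset (Fin m))),
    Finset.card_empty, pow_zero, one_smul, sum_heavyTablesOn_empty, ← sub_sub]
  simp only [add_sub_cancel]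
  refine (traceNorm_sub_le _ _).trans ((add_le_add
    (traceNorm_exp_pow_sub_pow_prod_exp_le hsum ha hδ hM)
    (traceNorm_sum_erase_empty_le hsum ha hδ₀ hδ hM L)).trans ?_)
  rw [← add_mul]
  refine mul_le_mul_of_nonneg_right ?_ (traceNorm_nonneg _)
  calc η * Real.exp η + Real.exp η * (Real.exp q - 1)
      = Real.exp η * (η + (Real.exp q - 1)) := by ring
    _ ≤ (1 + 2 * (ε / 8)) * (ε / 8 + 2 * (ε / 8)) := by
      gcongr
      · linarith [Real.add_one_le_exp q]
      · linarith
      · linarith [hexp η hη hstep]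
      · linarith [hexp q hq hcol]
    _ ≤ ε := by nlinarith

end TrotterError

section SchmidtRank

open scoped Kronecker

/-- `a ↦ a ⊗ 1`, from the operators on the spins in `S` to those on all spins, as a ring
homomorphism. -/
def extendOp {V : Type u} [Fintype V] [DecidableEq V] (d : ℕ) (S : Set V)
    [DecidablePred (· ∈ S)] : Matrix (S → Fin d) (S → Fin d) ℂ →+* Op V d where
  toFun a := (a ⊗ₖ (1 : Matrix ({v // v ∉ S} → Fin d) ({v // v ∉ S} → Fin d) ℂ)).submatrix
    (Equiv.piEquivPiSubtypeProd (· ∈ S) fun _ => Fin d)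
    (Equiv.piEquivPiSubtypeProd (· ∈ S) fun _ => Fin d)
  map_one' := by
    rw [Matrix.one_kronecker_one]
    exact Matrix.submatrix_one_equiv _
  map_mul' a b := by
    rw [Matrix.submatrix_mul_equiv, ← Matrix.mul_kronecker_mul, one_mul]
  map_zero' := by rw [Matrix.zero_kronecker]; rfl
  map_add' a b := by rw [Matrix.add_kronecker]; rfl

variable {V : Type u} [Fintype V] [DecidableEq V] {d : ℕ}

theorem extendOp_apply (S : Set V) [DecidablePred (· ∈ S)]
    (a : Matrix (S → Fin d) (S → Fin d) ℂ) (σ τ : V → Fin d) :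
    extendOp d S a σ τ =
      if ∀ v ∉ S, σ v = τ v then a (fun v => σ v) (fun v => τ v) else 0 := by
  have hone : (1 : Matrix ({v // v ∉ S} → Fin d) ({v // v ∉ S} → Fin d) ℂ)
      (fun v => σ v) (fun v => τ v) = if ∀ v ∉ S, σ v = τ v then 1 else 0 := by
    simp [Matrix.one_apply, funext_iff]
  calc extendOp d S a σ τ = a (fun v => σ v) (fun v => τ v) *
        (1 : Matrix ({v // v ∉ S} → Fin d) ({v // v ∉ S} → Fin d) ℂ)
          (fun v => σ v) (fun v => τ v) := rfl
    _ = _ := by rw [hone, mul_ite, mul_one, mul_zero]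

theorem extendOp_smul (S : Set V) [DecidablePred (· ∈ S)] (c : ℂ)
    (a : Matrix (S → Fin d) (S → Fin d) ℂ) : extendOp d S (c • a) = c • extendOp d S a := by
  ext σ τ
  simp [extendOp_apply]

theorem continuous_extendOp (S : Set V) [DecidablePred (· ∈ S)] : Continuous (extendOp d S) := by
  refine continuous_matrix fun σ τ => ?_
  simp only [extendOp_apply]
  split_ifs
  exacts [continuous_id.matrix_elem _ _, continuous_const]

theorem actsOn_iff_exists_eq_extendOp {S : Set V} [DecidablePred (· ∈ S)] {A : Op V d} :
    ActsOn S A ↔ ∃ a, A = extendOp d S a := by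
  refine exists_congr fun a => ⟨fun ha => ?_, ?_⟩
  · ext σ τ
    rw [extendOp_apply]
    split_ifs with hst
    · exact (ha σ τ).1 hst
    · push Not at hst
      exact (ha σ τ).2 hst
  · rintro rfl σ τ
    refine ⟨fun hst => ?_, fun hst => ?_⟩
    · rw [extendOp_apply, if_pos hst]
    · rw [extendOp_apply, if_neg (by push Not; exact hst)]

theorem ActsOn.exp_smul_sub_one {S : Set V} {A : Op V d} (hA : ActsOn S A) (c : ℂ) :
    ActsOn S (NormedSpace.exp (c • A) - 1) := by
  classical
  obtain ⟨a, rfl⟩ := actsOn_iff_exists_eq_extendOp.1 hA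
  refine actsOn_iff_exists_eq_extendOp.2 ⟨NormedSpace.exp (c • a) - 1, ?_⟩
  let : NormedAlgebra ℚ (Matrix (S → Fin d) (S → Fin d) ℂ) := .restrictScalars ℚ ℂ _
  rw [map_sub, map_one, NormedSpace.map_exp _ (continuous_extendOp S), extendOp_smul]

theorem siteTensor_pair_apply {v w : V} (hvw : v ≠ w) (A B : Matrix (Fin d) (Fin d) ℂ)
    (σ τ : V → Fin d) :
    siteTensor (fun u => if u = v then A else if u = w then B else 1) σ τ =
      if ∀ u, u ≠ v → u ≠ w → σ u = τ u then A (σ v) (τ v) * B (σ w) (τ w) else 0 := by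
  have hrest : ∏ u ∈ (Finset.univ.erase v).erase w,
      (if u = v then A else if u = w then B else 1) (σ u) (τ u) =
        if ∀ u, u ≠ v → u ≠ w → σ u = τ u then (1 : ℂ) else 0 :=
    calc _ = ∏ u ∈ (Finset.univ.erase v).erase w, if σ u = τ u then (1 : ℂ) else 0 :=
          Finset.prod_congr rfl fun u hu => by
            rw [Finset.mem_erase, Finset.mem_erase] at hu
            rw [if_neg hu.2.1, if_neg hu.1, Matrix.one_apply]
      _ = _ := by
        rw [Finset.prod_ite_zero, Finset.prod_const_one]
        congr 1
        simp only [Finset.mem_erase, Finset.mem_univ, and_true, and_imp, eq_iff_iff]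
        exact forall_congr' fun _ => forall_comm
  rw [siteTensor, Matrix.of_apply, ← Finset.mul_prod_erase _ _ (Finset.mem_univ v),
    ← Finset.mul_prod_erase (Finset.univ.erase v) _ (a := w) (by simp [hvw.symm]), hrest,
    if_pos rfl, if_neg hvw.symm, if_pos rfl, ← mul_assoc, mul_ite, mul_one, mul_zero]

theorem ActsOn.schmidtRankLE {e : Sym2 V} (he : ¬ e.IsDiag) {A : Op V d}
    (hA : ActsOn {u | u ∈ e} A) : SchmidtRankLE e (d ^ 2) A := by
  induction e with | _ v w
  rw [Sym2.mk_isDiag_iff] at he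
  obtain ⟨a, ha⟩ := hA
  set φ : Fin (d ^ 2) ≃ Fin d × Fin d := (Fintype.equivFinOfCardEq (by simp [sq])).symm
  set pairConfig : Fin d → Fin d → ({u | u ∈ s(v, w)} : Set V) → Fin d := fun p r u =>
    if (u : V) = v then p else r
  have hrestrict : ∀ σ : V → Fin d, (fun u : ({u | u ∈ s(v, w)} : Set V) => σ u) =
      pairConfig (σ v) (σ w) := fun σ => by
    funext u
    rcases Sym2.mem_iff.1 u.2 with h | h <;> simp [pairConfig, h, Ne.symm he]
  refine ⟨v, w, rfl, fun ν => Matrix.single (φ ν).1 (φ ν).2 1,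
    fun ν => Matrix.of fun r t => a (pairConfig (φ ν).1 r) (pairConfig (φ ν).2 t), ?_⟩
  ext σ τ
  simp only [Matrix.sum_apply, siteTensor_pair_apply he, Matrix.of_apply]
  by_cases hst : ∀ u, u ≠ v → u ≠ w → σ u = τ u
  · rw [(ha σ τ).1 fun u hu => by
      rw [Set.mem_ofPred_eq, Sym2.mem_iff, not_or] at hu
      exact hst u hu.1 hu.2, hrestrict, hrestrict, ← φ.symm.sum_comp]
    simp only [if_pos hst]
    simp [Fintype.sum_prod_type, Matrix.single_apply, ite_and]
  · simp only [if_neg hst, Finset.sum_const_zero]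
    push Not at hst
    obtain ⟨u, hv, hw, hne⟩ := hst
    exact (ha σ τ).2 ⟨u, by simp [hv, hw], hne⟩

theorem schmidtRankLE_trotterTerm {G : SimpleGraph V} {K : ℕ} (ord : Fin K ≃ G.edgeSet)
    {h : G.edgeSet → Op V d} (hh : IsInteraction G h) (β : ℝ) (M : ℕ) (i : Fin (K + K)) :
    SchmidtRankLE (ord (column K i) : Sym2 V) (d ^ 2) (trotterTerm ord h β M i) :=
  ((hh _).2.1.exp_smul_sub_one _).schmidtRankLE (G.not_isDiag_of_mem_edgeSet (ord _).2)

end SchmidtRank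

section ColumnLabels

/-- The labels of a column of a table: a choice of at most `L` of the `M` rows, the ones of the
column, together with one of `s` values in each of them. -/
abbrev ColumnLabel (M L s : ℕ) : Type :=
  {f : Fin M → Option (Fin s) // (Finset.univ.filter fun j => f j ≠ none).card ≤ L}

section Expansion

variable {R : Type*} [Semiring R] {M m s : ℕ}

theorem sum_pow_fin_two {κ : Type*} [Fintype κ] (y : κ → R) (b : Fin 2) :
    (∑ ν, y ν) ^ (b : ℕ) =
      ∑ o : Option κ with o.elim (0 : Fin 2) (fun _ => 1) = b, o.elim 1 y := by
  fin_cases b <;> simp [Finset.sum_filter]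

theorem tableProd_sum (y : Fin m → Fin s → R) (t : Fin M → Fin m → Fin 2) :
    tableProd (fun i => ∑ ν, y i ν) t =
      ∑ r : Fin M → Fin m → Option (Fin s) with
        (fun j i => (r j i).elim (0 : Fin 2) fun _ => 1) = t,
        ((List.finRange M).map fun j =>
          ((List.finRange m).map fun i => (r j i).elim 1 (y i)).prod).prod := by
  simp only [tableProd, sum_pow_fin_two, prod_finRange_sum]
  refine Finset.sum_congr ?_ fun _ _ => rfl
  ext r
  simp [Fintype.mem_piFinset, funext_iff]

theorem sum_light_tableProd_sum (L : ℕ) (y : Fin m → Fin s → R) :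
    ∑ t : Fin M → Fin m → Fin 2 with ∀ i, ∑ j, (t j i : ℕ) ≤ L,
        tableProd (fun i => ∑ ν, y i ν) t =
      ∑ α : Fin m → ColumnLabel M L s, ((List.finRange M).map fun j =>
        ((List.finRange m).map fun i => ((α i).1 j).elim 1 (y i)).prod).prod := by
  set support : (Fin M → Fin m → Option (Fin s)) → Fin M → Fin m → Fin 2 := fun r j i =>
    (r j i).elim 0 fun _ => 1
  have hsupport : ∀ r i, ∑ j, (support r j i : ℕ) =
      (Finset.univ.filter fun j => r j i ≠ none).card := fun r i => by
    rw [Finset.card_filter]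
    refine Finset.sum_congr rfl fun j _ => ?_
    cases h : r j i <;> simp [support, h]
  simp only [tableProd_sum]
  rw [Finset.sum_fiberwise_eq_sum_filter]
  simp only [Finset.mem_filter, Finset.mem_univ, true_and]
  refine Finset.sum_bij'
    (fun r hr i => ⟨fun j => r j i, hsupport r i ▸ (Finset.mem_filter.1 hr).2 i⟩)
    (fun α _ j i => (α i).1 j) (fun _ _ => Finset.mem_univ _) (fun α _ => ?_)
    (fun _ _ => rfl) (fun _ _ => rfl) (fun _ _ => rfl)
  exact Finset.mem_filter.2 ⟨Finset.mem_univ _, fun i =>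
    (hsupport (fun j i => (α i).1 j) i).trans_le (α i).2⟩

end Expansion

theorem card_filter_card_le {α : Type*} [Fintype α] (hα : 2 ≤ Fintype.card α) (L : ℕ) :
    (Finset.univ.filter fun A : Finset α => A.card ≤ L).card ≤ 2 * Fintype.card α ^ L := by
  have hfiber : ∀ l, ((Finset.univ.filter fun A : Finset α => A.card ≤ L).filter
      fun A => A.card = l).card ≤ Fintype.card α ^ l := fun l =>
    calc _ ≤ (Finset.powersetCard l (Finset.univ : Finset α)).card :=
          Finset.card_le_card fun A hA => by simp_all
      _ ≤ _ := by
        rw [Finset.card_powersetCard]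
        exact Nat.choose_le_pow _ _
  calc _ = ∑ l ∈ Finset.range (L + 1), ((Finset.univ.filter fun A : Finset α =>
        A.card ≤ L).filter fun A => A.card = l).card :=
        Finset.card_eq_sum_card_fiberwise fun A hA => by simp_all
    _ ≤ ∑ l ∈ Finset.range (L + 1), Fintype.card α ^ l := Finset.sum_le_sum fun l _ => hfiber l
    _ ≤ 2 * Fintype.card α ^ L := by
      rw [Finset.sum_range_succ, two_mul]
      gcongr
      exact (Nat.geomSum_lt hα fun k hk => Finset.mem_range.1 hk).le

theorem card_columnLabel_le {M L s : ℕ} (hL : 2 ≤ L) (hsM : 2 ≤ s * M) :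
    Fintype.card (ColumnLabel M L s) ≤ L * (s * M) ^ L := by
  have hcard : Fintype.card (Fin M × Fin s) = s * M := by simp [mul_comm]
  calc _ ≤ (Finset.univ.filter fun A : Finset (Fin M × Fin s) => A.card ≤ L).card := by
        refine Finset.card_le_card_of_injOn (s := Finset.univ)
          (fun f => Finset.univ.filter fun p => f.1 p.1 = some p.2) (fun f _ => ?_) ?_
        · refine Finset.mem_filter.2 ⟨Finset.mem_univ _, le_trans ?_ f.2⟩
          refine Finset.card_le_card_of_injOn Prod.fst (fun p hp => ?_) fun p hp q hq hpq => ?_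
          · simp_all
          · simp only [Finset.coe_filter, Finset.mem_univ, true_and, Set.mem_ofPred_eq] at hp hq
            rw [hpq, hq] at hp
            exact Prod.ext hpq (Option.some_injective _ hp).symm
        · intro f _ f' _ hff
          refine Subtype.ext (funext fun j => Option.ext fun ν => ?_)
          simpa using Finset.ext_iff.1 hff (j, ν)
    _ ≤ 2 * (s * M) ^ L := hcard ▸ card_filter_card_le (by rwa [hcard]) L
    _ ≤ L * (s * M) ^ L := Nat.mul_le_mul_right _ hL

end ColumnLabels

section PEPO

variable {V : Type u} [Fintype V] {d : ℕ}

theorem siteTensor_one : siteTensor (fun _ : V => (1 : Matrix (Fin d) (Fin d) ℂ)) = 1 := by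
  ext σ τ
  simp only [siteTensor, Matrix.of_apply, Matrix.one_apply]
  rw [Finset.prod_ite_zero]
  simp [funext_iff]

theorem option_elim_one_siteTensor {κ : Type*} (c : κ → V → Matrix (Fin d) (Fin d) ℂ)
    (o : Option κ) :
    o.elim 1 (fun ν => siteTensor (c ν)) = siteTensor fun v => o.elim 1 fun ν => c ν v := by
  cases o
  exacts [siteTensor_one.symm, rfl]

variable [DecidableEq V]

theorem siteTensor_mul (A B : V → Matrix (Fin d) (Fin d) ℂ) :
    siteTensor A * siteTensor B = siteTensor fun v => A v * B v := by
  ext σ τ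
  simp only [siteTensor, Matrix.mul_apply, Matrix.of_apply]
  rw [Finset.prod_univ_sum, Fintype.piFinset_univ]
  exact Finset.sum_congr rfl fun _ _ => Finset.prod_mul_distrib.symm

theorem prod_map_siteTensor {ι : Type*} (l : List ι) (f : ι → V → Matrix (Fin d) (Fin d) ℂ) :
    (l.map fun j => siteTensor (f j)).prod = siteTensor fun v => (l.map fun j => f j v).prod := by
  induction l with
  | nil => exact siteTensor_one.symm
  | cons a l ih => simp only [List.map_cons, List.prod_cons, ih, siteTensor_mul]

/-- A pair of labels attached to an edge serves the two columns carrying that edge: the first label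
is for the column among the first `K` ones, the second for the column among the last `K` ones. -/
def pickLabel {B : Type*} (K : ℕ) (i : Fin (K + K)) : B × B → B :=
  Fin.addCases (fun _ => Prod.fst) (fun _ => Prod.snd) i

/-- The bijection between labellings of the edges by pairs and labellings of the `2K` columns. -/
def edgeLabelEquiv {E B : Type*} {K : ℕ} (ord : Fin K ≃ E) :
    (E → B × B) ≃ (Fin (K + K) → B) where
  toFun b i := pickLabel K i (b (ord (column K i)))
  invFun α e := (α (Fin.castAdd K (ord.symm e).rev), α (Fin.natAdd K (ord.symm e)))
  left_inv b := by
    funext e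
    simp only [pickLabel, column, Fin.addCases_left, Fin.addCases_right, Fin.rev_rev, id,
      Equiv.apply_symm_apply]
  right_inv α := by
    funext i
    refine Fin.addCases (fun k => ?_) (fun k => ?_) i <;>
      simp only [pickLabel, column, Fin.addCases_left, Fin.addCases_right, Fin.rev_rev, id,
        Equiv.symm_apply_apply]

variable {G : SimpleGraph V} [DecidableRel G.Adj]

theorem isPEPO_sum_light {K M s : ℕ} (L : ℕ) (ord : Fin K ≃ G.edgeSet)
    (c : Fin (K + K) → Fin s → V → Matrix (Fin d) (Fin d) ℂ)
    (hc : ∀ i ν v, v ∉ (ord (column K i) : Sym2 V) → c i ν v = 1) :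
    IsPEPO G (Fintype.card (ColumnLabel M L s × ColumnLabel M L s))
      (∑ t : Fin M → Fin (K + K) → Fin 2 with ∀ i, ∑ j, (t j i : ℕ) ≤ L,
        tableProd (fun i => ∑ ν, siteTensor (c i ν)) t) := by
  classical
  set B := ColumnLabel M L s
  set φ : Fin (Fintype.card (B × B)) ≃ B × B := (Fintype.equivFin _).symm
  refine ⟨fun v γ => ((List.finRange M).map fun j => ((List.finRange (K + K)).map fun i =>
    if hi : v ∈ (ord (column K i) : Sym2 V) then
      ((pickLabel K i (φ (γ ⟨ord (column K i), hi⟩))).1 j).elim 1 fun ν => c i ν v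
    else 1).prod).prod, ?_⟩
  rw [sum_light_tableProd_sum, ← (edgeLabelEquiv ord).sum_comp,
    ← (Equiv.arrowCongr (Equiv.refl G.edgeSet) φ).sum_comp]
  simp only [option_elim_one_siteTensor, prod_map_siteTensor]
  refine Finset.sum_congr rfl fun α _ => ?_
  congr 1
  funext v
  congr 2
  funext j
  congr 2
  funext i
  split_ifs with hi
  · rfl
  · cases ((edgeLabelEquiv ord) ((Equiv.arrowCongr (Equiv.refl G.edgeSet) φ) α) i).1 j with
    | none => rfl
    | some ν => exact hc i ν v hi

theorem exists_isPEPO_truncatedTrotter {K M L s : ℕ} (ord : Fin K ≃ G.edgeSet)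
    (h : G.edgeSet → Op V d) (β : ℝ) (hL : 2 ≤ L) (hsM : 2 ≤ s * M)
    (hs : ∀ i, SchmidtRankLE (ord (column K i) : Sym2 V) s (trotterTerm ord h β M i)) :
    ∃ D : ℕ, IsPEPO G D (truncatedTrotter ord h β M L) ∧ D ≤ L ^ 2 * (s * M) ^ (2 * L) := by
  choose v w hvw a b hab using hs
  refine ⟨Fintype.card (ColumnLabel M L s × ColumnLabel M L s), ?_, ?_⟩
  · have := isPEPO_sum_light (M := M) L ord (fun i ν u => if u = v i then a i ν else
      if u = w i then b i ν else 1) fun i ν u hu => by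
        rw [hvw, Sym2.mem_iff, not_or] at hu
        rw [if_neg hu.1, if_neg hu.2]
    simp only [← hab] at this
    exact this
  · calc _ = Fintype.card (ColumnLabel M L s) ^ 2 := by rw [Fintype.card_prod, sq]
      _ ≤ (L * (s * M) ^ L) ^ 2 := Nat.pow_le_pow_left (card_columnLabel_le hL hsM) 2
      _ = L ^ 2 * (s * M) ^ (2 * L) := by ring

theorem IsPEPO.smul [Nonempty V] {D : ℕ} {ρ : Op V d} (hρ : IsPEPO G D ρ) (z : ℂ) :
    IsPEPO G D (z • ρ) := by
  obtain ⟨X, hX⟩ := hρ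
  obtain ⟨v₀⟩ := ‹Nonempty V›
  refine ⟨fun v γ => (if v = v₀ then z else 1) • X v γ, ?_⟩
  rw [hX, Finset.smul_sum]
  refine Finset.sum_congr rfl fun α _ => ?_
  ext σ τ
  simp only [Matrix.smul_apply, siteTensor, Matrix.of_apply, smul_eq_mul,
    Finset.prod_mul_distrib, Finset.prod_ite_eq', Finset.mem_univ, if_true]

theorem IsPEPO.isPEPS_col {D : ℕ} {ρ : Op V d} (hρ : IsPEPO G D ρ) (τ : V → Fin d) :
    IsPEPS G D fun σ => ρ σ τ := by
  obtain ⟨X, hX⟩ := hρ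
  refine ⟨fun v γ p => X v γ p (τ v), ?_⟩
  funext σ
  rw [hX, Matrix.sum_apply]
  rfl

end PEPO

section Gibbs

theorem sum_column {A : Type*} [AddCommMonoid A] {K : ℕ} (f : Fin K → A) :
    ∑ i, f (column K i) = 2 • ∑ k, f k := by
  rw [Fin.sum_univ_add, two_nsmul]
  simp only [column, Fin.addCases_left, Fin.addCases_right, id]
  congr 1
  exact Equiv.sum_comp Fin.revPerm f

variable {V : Type u} [Fintype V] {d : ℕ} {G : SimpleGraph V} [DecidableRel G.Adj]

theorem sum_smul_column {K M : ℕ} (ord : Fin K ≃ G.edgeSet) (h : G.edgeSet → Op V d) (β : ℝ) :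
    ∑ i, ((-(β / (2 * M)) : ℝ) : ℂ) • h (ord (column K i)) =
      ((-β / M : ℝ) : ℂ) • hamiltonian h := by
  rw [← Finset.smul_sum, sum_column fun k => h (ord k), ord.sum_comp h, hamiltonian,
    ← Nat.cast_smul_eq_nsmul ℂ, smul_smul]
  congr 1
  push_cast
  ring

variable [DecidableEq V]

theorem gibbs_eq_exp_pow {M : ℕ} (hM : M ≠ 0) (β : ℝ) (h : G.edgeSet → Op V d) :
    gibbs β h = NormedSpace.exp (((-β / M : ℝ) : ℂ) • hamiltonian h) ^ M := by
  have hM' : (M : ℂ) ≠ 0 := Nat.cast_ne_zero.2 hM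
  rw [← Matrix.exp_nsmul, gibbs, ← Nat.cast_smul_eq_nsmul ℂ, smul_smul]
  congr 2
  push_cast
  field_simp

theorem traceNorm_gibbs_sub_truncatedTrotter_le [NeZero d] {K : ℕ} (ord : Fin K ≃ G.edgeSet)
    {h : G.edgeSet → Op V d} (hh : IsInteraction G h) {β ε : ℝ} (hβ : 0 ≤ β) (hε₀ : 0 < ε)
    (hε : ε ≤ 1) {k M L : ℕ} (hM : M = 2 ^ (k + 1)) (hM₁ : 2 * β * K ≤ M)
    (hM₂ : 32 * β ^ 2 * K ^ 2 / ε ≤ M) (hL : 2 * K * Real.exp (5 * β - L) ≤ ε / 8) :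
    traceNorm (gibbs β h - truncatedTrotter ord h β M L) ≤ ε * traceNorm (gibbs β h) := by
  have hM₀ : (0 : ℝ) < M := by rw [hM]; positivity
  have hH : (((-β / M : ℝ) : ℂ) • hamiltonian h).IsHermitian :=
    (isHermitian_hamiltonian hh).smul (Complex.conj_ofReal _)
  have hnorm : ∀ i, ‖((-(β / (2 * M)) : ℝ) : ℂ) • h (ord (column K i))‖ ≤ β / (2 * M) := fun i => by
    rw [norm_smul, Complex.norm_real, norm_neg, Real.norm_of_nonneg (by positivity)]
    exact mul_le_of_le_one_right (by positivity) (hh _).2.2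
  have hstep : ((K + K : ℕ) : ℝ) * (β / (2 * M)) = β * K / M := by
    push_cast
    field_simp
    ring
  rw [gibbs_eq_exp_pow (Nat.cast_ne_zero.1 hM₀.ne'), ← sum_smul_column ord]
  rw [← sum_smul_column ord] at hH
  refine traceNorm_exp_pow_sub_sum_light_le hH hnorm (by positivity) ?_ hM hε ?_ ?_
  · rw [hstep, ← mul_div_assoc, div_le_one hM₀, ← mul_assoc]
    exact hM₁
  · rw [div_le_iff₀ hε₀] at hM₂
    rw [hstep]
    calc (M : ℝ) * (2 * (β * K / M)) ^ 2 = 4 * β ^ 2 * K ^ 2 / M := by field_simp; ring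
      _ ≤ ε / 8 := by rw [div_le_iff₀ hM₀]; linarith
  · have hrate : 10 * ((M : ℝ) * (β / (2 * M))) = 5 * β := by field_simp; ring
    rw [hrate]
    push_cast
    linarith

end Gibbs

section Parameters

theorem log_div_le_two_mul_log_div {x y ε : ℝ} (hx : 0 < x) (hy : 0 < y) (hxy : x ≤ y ^ 2)
    (hε₀ : 0 < ε) (hε : ε ≤ 1) : Real.log (x / ε) ≤ 2 * Real.log (y / ε) := by
  have hsq : x / ε ≤ (y / ε) ^ 2 := by
    rw [div_pow]
    exact div_le_div₀ (by positivity) hxy (by positivity) (pow_le_of_le_one hε₀.le hε two_ne_zero)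
  calc Real.log (x / ε) ≤ Real.log ((y / ε) ^ 2) := Real.log_le_log (by positivity) hsq
    _ = 2 * Real.log (y / ε) := by rw [Real.log_pow]; norm_cast

/-- The constant in the bounds on the number of Trotter steps and on the truncation order for
inverse temperatures of at most `b log (N / ε)`. -/
def trotterConst (b : ℝ) : ℝ := 7 + 10 * b + 256 * b ^ 2

theorem one_le_trotterConst {b : ℝ} (hb : 0 ≤ b) : 1 ≤ trotterConst b := by
  have : 0 ≤ 10 * b + 256 * b ^ 2 := by positivity
  unfold trotterConst
  linarith

theorem exists_trotter_steps {b K ε β : ℝ} (hb : 0 ≤ b) (hK : 1 ≤ K) (hε₀ : 0 < ε) (hε : ε ≤ 1)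
    (hβ : 0 ≤ β) (hβb : β ≤ 2 * b * (K / ε)) :
    ∃ k : ℕ, 2 * β * K ≤ (2 ^ (k + 1) : ℕ) ∧ 32 * β ^ 2 * K ^ 2 / ε ≤ (2 ^ (k + 1) : ℕ) ∧
      ((2 ^ (k + 1) : ℕ) : ℝ) ≤ trotterConst b * (K / ε) ^ 4 := by
  set r := K / ε with hr
  have hKr : K ≤ r := le_div_self (by linarith) hε₀ hε
  have hr₁ : 1 ≤ r := hK.trans hKr
  have hfirst : 2 * β * K ≤ 4 * b * r ^ 4 := by
    calc 2 * β * K ≤ 2 * (2 * b * r) * r := by gcongr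
      _ = 4 * b * r ^ 2 := by ring
      _ ≤ 4 * b * r ^ 4 := by gcongr; norm_num
  have hsecond : 32 * β ^ 2 * K ^ 2 / ε ≤ 128 * b ^ 2 * r ^ 4 := by
    calc 32 * β ^ 2 * K ^ 2 / ε = 32 * β ^ 2 * (K * r) := by rw [hr]; ring
      _ ≤ 32 * (2 * b * r) ^ 2 * (r * r) := by gcongr
      _ = 128 * b ^ 2 * r ^ 4 := by ring
  have hfirst₀ : 0 ≤ 2 * β * K := by positivity
  have hsecond₀ : 0 ≤ 32 * β ^ 2 * K ^ 2 / ε := by positivity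
  obtain ⟨k, hk, hk'⟩ := exists_nat_pow_near
    (show 1 ≤ 1 + 2 * β * K + 32 * β ^ 2 * K ^ 2 / ε by linarith) one_lt_two
  refine ⟨k, by push_cast; linarith, by push_cast; linarith, ?_⟩
  have hr₄ : 1 ≤ r ^ 4 := one_le_pow₀ hr₁
  calc ((2 ^ (k + 1) : ℕ) : ℝ) = 2 ^ k * 2 := by push_cast; ring
    _ ≤ (1 + 2 * β * K + 32 * β ^ 2 * K ^ 2 / ε) * 2 := by gcongr
    _ ≤ (r ^ 4 + 4 * b * r ^ 4 + 128 * b ^ 2 * r ^ 4) * 2 := by gcongr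
    _ = (2 + 8 * b + 256 * b ^ 2) * r ^ 4 := by ring
    _ ≤ trotterConst b * r ^ 4 := by unfold trotterConst; gcongr <;> norm_num

theorem exists_truncation_order {b r β : ℝ} (hr : 2 ≤ r) (hβ : 0 ≤ β)
    (hβb : β ≤ 2 * b * Real.log r) :
    ∃ L : ℕ, 2 ≤ L ∧ (L : ℝ) ≤ trotterConst b * Real.log r ∧
      Real.exp (5 * β - L) ≤ (16 * r)⁻¹ := by
  have hr₀ : 0 < r := by linarith
  have hlog_two := Real.log_two_gt_d9
  have hlog_r : Real.log 2 ≤ Real.log r := Real.log_le_log two_pos hr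
  have hlog : Real.log (16 * r) = 4 * Real.log 2 + Real.log r := by
    rw [Real.log_mul (by norm_num) hr₀.ne', show (16 : ℝ) = 2 ^ 4 by norm_num, Real.log_pow]
    norm_num
  set x := 5 * β + Real.log (16 * r)
  have hle : x ≤ ⌈x⌉₊ := Nat.le_ceil x
  have hlt : (⌈x⌉₊ : ℝ) < x + 1 := Nat.ceil_lt_add_one (by simp only [x]; linarith)
  refine ⟨⌈x⌉₊, Nat.lt_ceil.2 ?_, ?_, ?_⟩
  · simp only [x]
    push_cast
    linarith
  · calc (⌈x⌉₊ : ℝ) ≤ (7 + 10 * b) * Real.log r := by simp only [x] at hlt; linarith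
      _ ≤ trotterConst b * Real.log r := by
        refine mul_le_mul_of_nonneg_right ?_ (by linarith)
        unfold trotterConst
        linarith [sq_nonneg b]
  · calc Real.exp (5 * β - ⌈x⌉₊) ≤ Real.exp (-Real.log (16 * r)) :=
          Real.exp_le_exp.2 (by simp only [x] at hle; linarith)
      _ = (16 * r)⁻¹ := by rw [Real.exp_neg, Real.exp_log (by positivity)]

theorem natCast_mul_le_exp {C r : ℝ} {q s M : ℕ} (hr : 2 ≤ r) (hC : 1 ≤ (q : ℝ) * C)
    (hs : s ≤ q) (hM : (M : ℝ) ≤ C * r ^ 4) :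
    ((s * M : ℕ) : ℝ) ≤ Real.exp ((2 * Real.log (q * C) + 4) * Real.log r) := by
  have hr₀ : 0 < r := by linarith
  have hlog_r : 1 ≤ 2 * Real.log r := by
    linarith [Real.log_two_gt_d9, Real.log_le_log two_pos hr]
  calc ((s * M : ℕ) : ℝ) ≤ q * (C * r ^ 4) := by push_cast; gcongr
    _ = Real.exp (Real.log (q * C) + 4 * Real.log r) := by
      rw [Real.exp_add, Real.exp_log (by linarith), mul_comm 4, ← Real.rpow_def_of_pos hr₀,
        mul_assoc]
      norm_cast
    _ ≤ Real.exp ((2 * Real.log (q * C) + 4) * Real.log r) := by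
      refine Real.exp_le_exp.2 ?_
      linarith [mul_le_mul_of_nonneg_left hlog_r (Real.log_nonneg hC)]

theorem sq_mul_pow_le_exp {C c Λ : ℝ} {L m : ℕ} (hc : 0 ≤ c) (hC : 0 ≤ C) (hΛ : 1 ≤ 2 * Λ)
    (hL : (L : ℝ) ≤ C * Λ) (hm : (m : ℝ) ≤ Real.exp (c * Λ)) :
    ((L ^ 2 * m ^ (2 * L) : ℕ) : ℝ) ≤ Real.exp (C * (4 + 2 * c) * Λ ^ 2) := by
  have hΛ₀ : 0 ≤ Λ := by linarith
  have hL_exp : (L : ℝ) ≤ Real.exp L := (lt_add_one _).le.trans (Real.add_one_le_exp _)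
  calc ((L ^ 2 * m ^ (2 * L) : ℕ) : ℝ) ≤ Real.exp L ^ 2 * Real.exp (c * Λ) ^ (2 * L) := by
        push_cast
        gcongr
    _ = Real.exp (2 * L * (1 + c * Λ)) := by
        rw [← Real.exp_nat_mul, ← Real.exp_nat_mul, ← Real.exp_add]
        push_cast
        ring_nf
    _ ≤ Real.exp (2 * (C * Λ) * (2 * Λ + c * Λ)) := by gcongr
    _ = Real.exp (C * (4 + 2 * c) * Λ ^ 2) := by ring_nf

/-- The constant in the exponent of the bound on the bond dimension. -/
def bondConst (b : ℝ) (d : ℕ) : ℝ :=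
  4 * (trotterConst b * (12 + 4 * Real.log ((d ^ 2 : ℕ) * trotterConst b)))

theorem one_le_sq_mul_trotterConst {b : ℝ} (hb : 0 ≤ b) (d : ℕ) [NeZero d] :
    1 ≤ ((d ^ 2 : ℕ) : ℝ) * trotterConst b :=
  one_le_mul_of_one_le_of_one_le (mod_cast Nat.one_le_pow _ _ (NeZero.pos d))
    (one_le_trotterConst hb)

theorem bondConst_pos {b : ℝ} (hb : 0 ≤ b) (d : ℕ) [NeZero d] : 0 < bondConst b d := by
  have hlog := Real.log_nonneg (one_le_sq_mul_trotterConst hb d)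
  have hC := one_le_trotterConst hb
  unfold bondConst
  positivity

theorem bondDimension_le_exp {b r ℓ : ℝ} {d s M L : ℕ} [NeZero d] (hb : 0 ≤ b) (hr : 2 ≤ r)
    (hℓ : Real.log r ≤ 2 * ℓ) (hs : s ≤ d ^ 2) (hM : (M : ℝ) ≤ trotterConst b * r ^ 4)
    (hL : (L : ℝ) ≤ trotterConst b * Real.log r) :
    ((L ^ 2 * (s * M) ^ (2 * L) : ℕ) : ℝ) ≤ Real.exp (bondConst b d * ℓ ^ 2) := by
  have hC := one_le_trotterConst hb
  have hdC := one_le_sq_mul_trotterConst hb d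
  have ha := Real.log_nonneg hdC
  have hlog : 1 ≤ 2 * Real.log r := by
    linarith [Real.log_two_gt_d9, Real.log_le_log two_pos hr]
  set a := Real.log ((d ^ 2 : ℕ) * trotterConst b)
  calc _ ≤ Real.exp (trotterConst b * (4 + 2 * (2 * a + 4)) * Real.log r ^ 2) :=
        sq_mul_pow_le_exp (by positivity) (by positivity) hlog hL
          (natCast_mul_le_exp hr hdC hs hM)
    _ ≤ Real.exp (trotterConst b * (4 + 2 * (2 * a + 4)) * (2 * ℓ) ^ 2) := by
        gcongr
        linarith
    _ = Real.exp (bondConst b d * ℓ ^ 2) := by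
        rw [bondConst]
        congr 1
        ring

end Parameters

section GibbsApproximation

variable {V : Type u} [Fintype V] {G : SimpleGraph V} [DecidableRel G.Adj]

theorem card_le_two_mul_card_edgeFinset (hG : ∀ v, 0 < G.degree v) :
    Fintype.card V ≤ 2 * G.edgeFinset.card := by
  rw [← G.sum_degrees_eq_twice_card_edges, ← Finset.card_univ, Finset.card_eq_sum_ones]
  exact Finset.sum_le_sum fun v _ => hG v

theorem card_edgeFinset_le_sq_card : G.edgeFinset.card ≤ Fintype.card V ^ 2 :=
  G.card_edgeFinset_le_card_choose_two.trans (Nat.choose_le_pow _ _)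

variable [DecidableEq V] {d : ℕ} [NeZero d]

theorem exists_truncatedTrotter_approx (hG : ∀ v, 0 < G.degree v) {K : ℕ} (hK : 2 ≤ K)
    (ord : Fin K ≃ G.edgeSet) {h : G.edgeSet → Op V d} (hh : IsInteraction G h) {b β ε : ℝ}
    (hb : 0 ≤ b) (hβ : 0 ≤ β) (hβb : β ≤ b * Real.log (Fintype.card V / ε)) (hε₀ : 0 < ε)
    (hε : ε ≤ 1) :
    ∃ M L : ℕ, 1 ≤ M ∧ (M : ℝ) ≤ trotterConst b * (K / ε) ^ 4 ∧
      (L : ℝ) ≤ trotterConst b * Real.log (K / ε) ∧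
      traceNorm (gibbs β h - truncatedTrotter ord h β M L) ≤ ε * traceNorm (gibbs β h) ∧
      ∀ s : ℕ, 1 ≤ s → s ≤ d ^ 2 →
        (∀ i, SchmidtRankLE (ord (column K i) : Sym2 V) s (trotterTerm ord h β M i)) →
        ∃ D : ℕ, IsPEPO G D (truncatedTrotter ord h β M L) ∧ D ≤ L ^ 2 * (s * M) ^ (2 * L) ∧
          (D : ℝ) ≤ Real.exp (bondConst b d * Real.log (Fintype.card V / ε) ^ 2) := by
  have hcard : G.edgeFinset.card = K := by
    rw [SimpleGraph.edgeFinset_card, ← Fintype.card_congr ord, Fintype.card_fin]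
  have hVK : (Fintype.card V : ℝ) ≤ 2 * K := mod_cast hcard ▸ card_le_two_mul_card_edgeFinset hG
  have hKV : (K : ℝ) ≤ (Fintype.card V : ℝ) ^ 2 := mod_cast hcard ▸ card_edgeFinset_le_sq_card
  have hK₂ : (2 : ℝ) ≤ K := mod_cast hK
  have hV₀ : (0 : ℝ) < Fintype.card V :=
    (Nat.cast_nonneg _).lt_of_ne' (by rintro hzero; rw [hzero] at hKV; linarith)
  have hKε : (K : ℝ) ≤ K / ε := le_div_self (by linarith) hε₀ hε
  have hlogV : Real.log (Fintype.card V / ε) ≤ 2 * Real.log (K / ε) :=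
    log_div_le_two_mul_log_div hV₀ (by linarith) (by nlinarith) hε₀ hε
  have hlogK : Real.log (K / ε) ≤ 2 * Real.log (Fintype.card V / ε) :=
    log_div_le_two_mul_log_div (by linarith) hV₀ hKV hε₀ hε
  have hβ_log : β ≤ 2 * b * Real.log (K / ε) := by
    linarith [mul_le_mul_of_nonneg_left hlogV hb]
  obtain ⟨k, hM₁, hM₂, hM⟩ := exists_trotter_steps hb (one_le_two.trans hK₂) hε₀ hε hβ
    (hβ_log.trans (by gcongr; exact Real.log_le_self (by positivity)))
  obtain ⟨L, hL₂, hL, hL_exp⟩ := exists_truncation_order (hK₂.trans hKε) hβ hβ_log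
  refine ⟨2 ^ (k + 1), L, Nat.one_le_two_pow, hM, hL, ?_, fun s hs₁ hs hrank => ?_⟩
  · refine traceNorm_gibbs_sub_truncatedTrotter_le ord hh hβ hε₀ hε rfl hM₁ hM₂ ?_
    calc 2 * K * Real.exp (5 * β - L) ≤ 2 * K * (16 * (K / ε))⁻¹ := by gcongr
      _ = ε / 8 := by field_simp; norm_num
  · have hsM : 2 ≤ s * 2 ^ (k + 1) :=
      (Nat.le_self_pow k.succ_ne_zero 2).trans (Nat.le_mul_of_pos_left _ hs₁)
    obtain ⟨D, hD, hDL⟩ := exists_isPEPO_truncatedTrotter ord h β hL₂ hsM hrank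
    exact ⟨D, hD, hDL, (Nat.cast_le.2 hDL).trans
      (bondDimension_le_exp hb (hK₂.trans hKε) hlogK hs hM hL)⟩

end GibbsApproximation

section Spectral

variable {n : Type*} [Fintype n]

theorem norm_toLp_eq_one {v : n → ℂ} (hv : star v ⬝ᵥ v = 1) : ‖WithLp.toLp 2 v‖ = 1 := by
  rw [dotProduct_star_self_eq_norm_sq, ← Complex.ofReal_one, Complex.ofReal_inj] at hv
  exact (pow_eq_one_iff_of_nonneg (norm_nonneg _) two_ne_zero).1 hv

theorem dotProduct_star_eq_inner (v w : n → ℂ) :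
    v ⬝ᵥ star w = inner ℂ (WithLp.toLp 2 w) (WithLp.toLp 2 v) :=
  (EuclideanSpace.inner_toLp_toLp w v).symm

variable {H : Matrix n n ℂ}

theorem star_dotProduct_mulVec_of_mulVec_eq_smul (hH : H.IsHermitian) {v : n → ℂ} {c : ℝ}
    (hv : H *ᵥ v = (c : ℂ) • v) (w : n → ℂ) : star v ⬝ᵥ (H *ᵥ w) = c * (star v ⬝ᵥ w) := by
  rw [Matrix.dotProduct_mulVec, ← hH.eq, ← Matrix.star_mulVec, hv, star_smul, smul_dotProduct,
    Complex.star_def, Complex.conj_ofReal, smul_eq_mul]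

variable [DecidableEq n]

theorem traceNorm_vecMulVec_star_le (v w : n → ℂ) :
    traceNorm (Matrix.vecMulVec v (star w)) ≤ ‖WithLp.toLp 2 w‖ * ‖WithLp.toLp 2 v‖ :=
  traceNorm_le_of_forall fun U hU => by
    rw [Matrix.mul_vecMulVec, Matrix.trace_vecMulVec, dotProduct_star_eq_inner]
    refine (norm_inner_le_norm _ _).trans ?_
    gcongr
    exact (Matrix.l2_opNorm_mulVec U (WithLp.toLp 2 v)).trans
      (mul_le_of_le_one_left (norm_nonneg _) hU)

theorem conjStarAlgAut_diagonal_eq_sum (hH : H.IsHermitian) (f : n → ℂ) :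
    Unitary.conjStarAlgAut ℂ _ hH.eigenvectorUnitary (Matrix.diagonal f) =
      ∑ i, f i • Matrix.vecMulVec (hH.eigenvectorBasis i).ofLp
        (star (hH.eigenvectorBasis i).ofLp) := by
  ext p q
  rw [Unitary.conjStarAlgAut_apply, Matrix.sum_apply, Matrix.mul_apply]
  refine Finset.sum_congr rfl fun i _ => ?_
  rw [Matrix.mul_diagonal, Matrix.smul_apply, Matrix.vecMulVec_apply, smul_eq_mul, mul_assoc,
    mul_left_comm]
  rfl

theorem exp_smul_eq_sum (hH : H.IsHermitian) (c : ℝ) :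
    NormedSpace.exp ((c : ℂ) • H) = ∑ i, ((Real.exp (c * hH.eigenvalues i) : ℝ) : ℂ) •
      Matrix.vecMulVec (hH.eigenvectorBasis i).ofLp (star (hH.eigenvectorBasis i).ofLp) := by
  set φ := Unitary.conjStarAlgAut ℂ _ hH.eigenvectorUnitary
  have hφ : Continuous φ :=
    (continuous_const.mul continuous_id).mul continuous_const
  have hdiag : (c : ℂ) • H = φ (Matrix.diagonal fun i => ((c * hH.eigenvalues i : ℝ) : ℂ)) := by
    conv_lhs => rw [hH.spectral_theorem, ← map_smul, ← Matrix.diagonal_smul]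
    congr 2
    funext i
    simp
  let : NormedAlgebra ℚ (Matrix n n ℂ) := .restrictScalars ℚ ℂ _
  rw [hdiag, ← NormedSpace.map_exp φ hφ, Matrix.exp_diagonal, conjStarAlgAut_diagonal_eq_sum]
  simp only [Pi.coe_exp, ← Complex.exp_eq_exp_ℂ, Complex.ofReal_exp]

theorem star_eigenvectorBasis_dotProduct (hH : H.IsHermitian) (i j : n) :
    star (hH.eigenvectorBasis i).ofLp ⬝ᵥ (hH.eigenvectorBasis j).ofLp = if i = j then 1 else 0 := by
  rw [dotProduct_comm, dotProduct_star_eq_inner]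
  exact orthonormal_iff_ite.1 hH.eigenvectorBasis.orthonormal i j

theorem mulVec_eigenvectorBasis_eq_smul (hH : H.IsHermitian) (i : n) :
    H *ᵥ (hH.eigenvectorBasis i).ofLp =
      (hH.eigenvalues i : ℂ) • (hH.eigenvectorBasis i).ofLp :=
  (hH.mulVec_eigenvectorBasis i).trans (Complex.coe_smul _ _).symm

theorem exists_star_dotProduct_eigenvectorBasis_ne_zero (hH : H.IsHermitian) {v : n → ℂ}
    (hv : v ≠ 0) : ∃ i, star v ⬝ᵥ (hH.eigenvectorBasis i).ofLp ≠ 0 := by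
  by_contra! horth
  refine hv (congrArg WithLp.ofLp (hH.eigenvectorBasis.repr.map_eq_zero_iff.1 ?_ :
    WithLp.toLp 2 v = 0))
  ext i
  rw [OrthonormalBasis.repr_apply_apply, ← inner_conj_symm, PiLp.zero_apply, map_eq_zero,
    ← horth i, dotProduct_comm, dotProduct_star_eq_inner]

end Spectral

section Gap

variable {V : Type u} [Fintype V] [DecidableEq V] {d : ℕ} {A : Op V d} {Ψ : (V → Fin d) → ℂ}
  {E₀ Δ : ℝ}

theorem IsGappedGroundState.eq_smul (hΨ : IsGappedGroundState A Ψ E₀ Δ) (hΔ : 0 < Δ)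
    {φ : (V → Fin d) → ℂ} (hφ : A *ᵥ φ = (E₀ : ℂ) • φ) : φ = (star Ψ ⬝ᵥ φ) • Ψ := by
  obtain ⟨hnorm, hE₀, hgap⟩ := hΨ
  by_contra hne
  have horth : star Ψ ⬝ᵥ (φ - (star Ψ ⬝ᵥ φ) • Ψ) = 0 := by
    rw [dotProduct_sub, dotProduct_smul, hnorm, smul_eq_mul, mul_one, sub_self]
  have heigen : A *ᵥ (φ - (star Ψ ⬝ᵥ φ) • Ψ) = (E₀ : ℂ) • (φ - (star Ψ ⬝ᵥ φ) • Ψ) := by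
    rw [Matrix.mulVec_sub, Matrix.mulVec_smul, hE₀, hφ, smul_sub, smul_comm]
  linarith [hgap _ E₀ (sub_ne_zero.2 hne) horth heigen]

theorem IsGappedGroundState.ne_zero (hΨ : IsGappedGroundState A Ψ E₀ Δ) : Ψ ≠ 0 := by
  rintro rfl
  simpa using hΨ.1

theorem IsGappedGroundState.exists_index (hΨ : IsGappedGroundState A Ψ E₀ Δ) (hΔ : 0 < Δ)
    (hA : A.IsHermitian) :
    ∃ i₀, hA.eigenvalues i₀ = E₀ ∧ (∀ i, i ≠ i₀ → E₀ + Δ ≤ hA.eigenvalues i) ∧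
      Matrix.vecMulVec (hA.eigenvectorBasis i₀).ofLp (star (hA.eigenvectorBasis i₀).ofLp) =
        Matrix.vecMulVec Ψ (star Ψ) := by
  obtain ⟨i₀, hi₀⟩ := exists_star_dotProduct_eigenvectorBasis_ne_zero hA hΨ.ne_zero
  set b : (V → Fin d) → (V → Fin d) → ℂ := fun i => (hA.eigenvectorBasis i).ofLp
  have hbb : ∀ i j, star (b i) ⬝ᵥ b j = if i = j then 1 else 0 :=
    star_eigenvectorBasis_dotProduct hA
  have hE₀ : hA.eigenvalues i₀ = E₀ := by
    have hinner := star_dotProduct_mulVec_of_mulVec_eq_smul hA hΨ.2.1 (b i₀)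
    rw [mulVec_eigenvectorBasis_eq_smul, dotProduct_smul, smul_eq_mul] at hinner
    exact Complex.ofReal_injective (mul_right_cancel₀ hi₀ hinner)
  set c := star Ψ ⬝ᵥ b i₀
  have hc : b i₀ = c • Ψ :=
    hΨ.eq_smul hΔ (by rw [mulVec_eigenvectorBasis_eq_smul, hE₀])
  have hphase : c * star c = 1 := by
    have hnorm := hbb i₀ i₀
    rw [if_pos rfl, hc, star_smul, smul_dotProduct, dotProduct_smul, hΨ.1] at hnorm
    rwa [smul_eq_mul, smul_eq_mul, mul_one, mul_comm] at hnorm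
  refine ⟨i₀, hE₀, fun i hi => hΨ.2.2 (b i) _ (fun hzero => ?_) ?_
    (mulVec_eigenvectorBasis_eq_smul hA i), ?_⟩
  · have hnorm := hbb i i
    rw [hzero, dotProduct_zero, if_pos rfl] at hnorm
    exact zero_ne_one hnorm
  · have horth := hbb i₀ i
    rw [if_neg hi.symm, hc, star_smul, smul_dotProduct, smul_eq_mul] at horth
    exact (mul_eq_zero.1 horth).resolve_left (right_ne_zero_of_mul_eq_one hphase)
  · change Matrix.vecMulVec (b i₀) (star (b i₀)) = _
    rw [hc, star_smul, Matrix.smul_vecMulVec, Matrix.vecMulVec_smul, smul_smul, hphase, one_smul]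

theorem traceNorm_projection_sub_gibbs_le {G : SimpleGraph V} [DecidableRel G.Adj]
    {h : G.edgeSet → Op V d} (hH : (hamiltonian h).IsHermitian) {i₀ : V → Fin d} {β : ℝ}
    (hE₀ : hH.eigenvalues i₀ = E₀)
    (hΨ : Matrix.vecMulVec (hH.eigenvectorBasis i₀).ofLp (star (hH.eigenvectorBasis i₀).ofLp) =
      Matrix.vecMulVec Ψ (star Ψ)) :
    traceNorm (Matrix.vecMulVec Ψ (star Ψ) - ((Real.exp (β * E₀) : ℝ) : ℂ) • gibbs β h) ≤
      ∑ i ∈ Finset.univ.erase i₀, Real.exp (-(β * (hH.eigenvalues i - E₀))) := by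
  set P : (V → Fin d) → Op V d := fun i =>
    Matrix.vecMulVec (hH.eigenvectorBasis i).ofLp (star (hH.eigenvectorBasis i).ofLp)
  have hP : ∀ i, traceNorm (P i) ≤ 1 := fun i => by
    have hunit := norm_toLp_eq_one ((star_eigenvectorBasis_dotProduct hH i i).trans (if_pos rfl))
    exact (traceNorm_vecMulVec_star_le _ _).trans (by rw [hunit, one_mul])
  have hgibbs : ((Real.exp (β * E₀) : ℝ) : ℂ) • gibbs β h =
      ∑ i, ((Real.exp (-(β * (hH.eigenvalues i - E₀))) : ℝ) : ℂ) • P i := by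
    rw [gibbs, exp_smul_eq_sum hH, Finset.smul_sum]
    refine Finset.sum_congr rfl fun i _ => ?_
    rw [smul_smul, ← Complex.ofReal_mul, ← Real.exp_add]
    congr 3
    ring
  have hexcited : Matrix.vecMulVec Ψ (star Ψ) - ((Real.exp (β * E₀) : ℝ) : ℂ) • gibbs β h =
      ∑ i ∈ Finset.univ.erase i₀,
        (-((Real.exp (-(β * (hH.eigenvalues i - E₀))) : ℝ) : ℂ)) • P i := by
    rw [hgibbs, ← Finset.add_sum_erase _ _ (Finset.mem_univ i₀), hE₀, ← hΨ]
    simp [P]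
  rw [hexcited]
  refine (traceNorm_sum_le _ _).trans (Finset.sum_le_sum fun i _ => ?_)
  rw [traceNorm_smul, norm_neg, Complex.norm_real, Real.norm_of_nonneg (Real.exp_nonneg _)]
  exact mul_le_of_le_one_right (Real.exp_nonneg _) (hP i)

end Gap

section LevelSum

theorem mul_floor_add_one_le {Δ y : ℝ} (hΔ : 0 < Δ) (hy : Δ ≤ y) :
    Δ / (1 + Δ) * (⌊y⌋₊ + 1) ≤ y := by
  have hfloor : (⌊y⌋₊ : ℝ) ≤ y := Nat.floor_le (hΔ.le.trans hy)
  rw [div_mul_eq_mul_div, div_le_iff₀ (by positivity)]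
  nlinarith

theorem exp_neg_mul_le_pow_floor {Δ y β : ℝ} (hΔ : 0 < Δ) (hy : Δ ≤ y) (hβ : 0 ≤ β) :
    Real.exp (-(β * y)) ≤ Real.exp (-(β * (Δ / (1 + Δ)))) ^ (⌊y⌋₊ + 1) := by
  rw [← Real.exp_nat_mul, Real.exp_le_exp]
  have hfloor := mul_le_mul_of_nonneg_left (mul_floor_add_one_le hΔ hy) hβ
  push_cast
  linarith

theorem sum_pow_succ_le_two_mul {w : ℝ} (hw₀ : 0 ≤ w) (hw : w ≤ 1 / 2) (R : ℕ) :
    ∑ m ∈ Finset.range R, w ^ (m + 1) ≤ 2 * w := by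
  have hgeom : ∑ m ∈ Finset.range R, w ^ m ≤ 2 := by
    have hsum₀ : 0 ≤ ∑ m ∈ Finset.range R, w ^ m := by positivity
    nlinarith [mul_neg_geom_sum w R, pow_nonneg hw₀ R]
  simp only [pow_succ, ← Finset.sum_mul]
  exact mul_le_mul_of_nonneg_right hgeom hw₀

variable {ι : Type*} {s : Finset ι} {y : ι → ℝ} {N κ : ℝ}

theorem card_filter_floor_le (hN : 1 ≤ N) (hκ : 0 ≤ κ)
    (hcount : ∀ E : ℝ, 0 ≤ E → ((s.filter fun i => y i ≤ E).card : ℝ) ≤ N ^ (κ * (1 + E)))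
    (m : ℕ) : ((s.filter fun i => ⌊y i⌋₊ = m).card : ℝ) ≤ (N ^ (2 * κ)) ^ (m + 1) := by
  calc ((s.filter fun i => ⌊y i⌋₊ = m).card : ℝ)
      ≤ (s.filter fun i => y i ≤ m + 1).card := by
        refine Nat.cast_le.2 (Finset.card_le_card (Finset.monotone_filter_right s fun i _ hi => ?_))
        exact hi ▸ (Nat.lt_floor_add_one (y i)).le
    _ ≤ N ^ (κ * (1 + (m + 1))) := hcount _ (by positivity)
    _ ≤ N ^ (2 * κ * (m + 1 : ℕ)) := by
        refine Real.rpow_le_rpow_of_exponent_le hN ?_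
        push_cast
        linarith [mul_nonneg hκ m.cast_nonneg]
    _ = (N ^ (2 * κ)) ^ (m + 1) := by rw [Real.rpow_mul (by positivity), Real.rpow_natCast]

theorem sum_exp_neg_mul_le_two_mul {Δ β w : ℝ} (hN : 1 ≤ N) (hκ : 0 ≤ κ)
    (hcount : ∀ E : ℝ, 0 ≤ E → ((s.filter fun i => y i ≤ E).card : ℝ) ≤ N ^ (κ * (1 + E)))
    (hΔ : 0 < Δ) (hy : ∀ i ∈ s, Δ ≤ y i) (hβ : 0 ≤ β)
    (hw : N ^ (2 * κ) * Real.exp (-(β * (Δ / (1 + Δ)))) ≤ w) (hw₂ : w ≤ 1 / 2) :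
    ∑ i ∈ s, Real.exp (-(β * y i)) ≤ 2 * w := by
  set q := Real.exp (-(β * (Δ / (1 + Δ))))
  have hmaps : ∀ i ∈ s, ⌊y i⌋₊ ∈ Finset.range (s.sup (fun i => ⌊y i⌋₊) + 1) := fun i hi =>
    Finset.mem_range_succ_iff.2 (Finset.le_sup (f := fun i => ⌊y i⌋₊) hi)
  rw [← Finset.sum_fiberwise_of_maps_to hmaps]
  have hw₀ : 0 ≤ w := le_trans (by positivity) hw
  refine (Finset.sum_le_sum fun m _ => ?_).trans (sum_pow_succ_le_two_mul hw₀ hw₂ _)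
  calc ∑ i ∈ s.filter fun i => ⌊y i⌋₊ = m, Real.exp (-(β * y i))
      ≤ ∑ _i ∈ s.filter fun i => ⌊y i⌋₊ = m, q ^ (m + 1) := by
        refine Finset.sum_le_sum fun i hi => ?_
        obtain ⟨his, rfl⟩ := Finset.mem_filter.1 hi
        exact exp_neg_mul_le_pow_floor hΔ (hy i his) hβ
    _ ≤ (N ^ (2 * κ)) ^ (m + 1) * q ^ (m + 1) := by
        rw [Finset.sum_const, nsmul_eq_mul]
        gcongr
        exact card_filter_floor_le hN hκ hcount m
    _ ≤ w ^ (m + 1) := by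
        rw [← mul_pow]
        gcongr

theorem rpow_mul_exp_neg_le {η : ℝ} (hN : 1 ≤ N) (hκ : 0 ≤ κ) (hη₀ : 0 < η) (hη : η ≤ 1) :
    N ^ (2 * κ) * Real.exp (-((2 * κ + 1) * Real.log (N / η))) ≤ η := by
  have hN₀ : 0 < N := by positivity
  have hlogN := Real.log_nonneg hN
  have hlogη := mul_nonpos_of_nonneg_of_nonpos hκ (Real.log_nonpos hη₀.le hη)
  rw [Real.rpow_def_of_pos hN₀, ← Real.exp_add, Real.log_div hN₀.ne' hη₀.ne']
  refine (Real.exp_le_exp.2 ?_).trans (Real.exp_log hη₀).le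
  linarith

theorem log_div_nonneg {η : ℝ} (hN : 1 ≤ N) (hη₀ : 0 < η) (hη : η ≤ 1) :
    0 ≤ Real.log (N / η) :=
  Real.log_nonneg (hN.trans (le_div_self (by linarith) hη₀ hη))

theorem log_div_div_four_le {ε : ℝ} (hN : 2 ≤ N) (hε₀ : 0 < ε) (hε : ε ≤ 1) :
    Real.log (N / (ε / 4)) ≤ 3 * Real.log (N / ε) := by
  have htwo : (2 : ℝ) ≤ N / ε := hN.trans (le_div_self (by linarith) hε₀ hε)
  have hfactor : N / (ε / 4) = 2 ^ 2 * (N / ε) := by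
    field_simp
    norm_num
  rw [hfactor, Real.log_mul (by norm_num) (by linarith), Real.log_pow]
  push_cast
  linarith [Real.log_le_log two_pos htwo]

end LevelSum

section Column

theorem exists_pos_and_le_mul_of_sum_le {ι : Type*} [Fintype ι] {f g : ι → ℝ} {c : ℝ}
    (hf : ∀ i, 0 ≤ f i) (hg : ∀ i, 0 ≤ g i) (hpos : 0 < ∑ i, g i)
    (hsum : ∑ i, f i ≤ c * ∑ i, g i) : ∃ i, 0 < g i ∧ f i ≤ c * g i := by
  by_contra! hlt
  obtain ⟨j, -, hj⟩ := Finset.exists_lt_of_sum_lt (Finset.sum_const_zero.trans_lt hpos)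
  refine hsum.not_gt ?_
  rw [Finset.mul_sum]
  refine Finset.sum_lt_sum (fun i _ => ?_) ⟨j, Finset.mem_univ _, hlt j hj⟩
  obtain hi | hi := (hg i).eq_or_lt
  · rw [← hi, mul_zero]
    exact hf i
  · exact (hlt i hi).le

theorem exists_norm_sub_smul_column_le {n : Type*} [Fintype n] [DecidableEq n] {Ψ : n → ℂ}
    (hΨ : star Ψ ⬝ᵥ Ψ = 1) {σ : Matrix n n ℂ} {ε : ℝ}
    (hσ : traceNorm (Matrix.vecMulVec Ψ (star Ψ) - σ) ≤ ε) :
    ∃ (τ : n) (z : ℂ), ‖WithLp.toLp 2 (Ψ - fun p => z * σ p τ)‖ ≤ ε := by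
  set R := Matrix.vecMulVec Ψ (star Ψ) - σ with hR
  have hε : 0 ≤ ε := (traceNorm_nonneg R).trans hσ
  have hunit : ∑ τ, ‖Ψ τ‖ ^ 2 = 1 := by
    rw [← EuclideanSpace.norm_sq_eq (WithLp.toLp 2 Ψ), norm_toLp_eq_one hΨ, one_pow]
  have htotal : ∑ τ, ∑ p, ‖R p τ‖ ^ 2 ≤ ε ^ 2 * ∑ τ, ‖Ψ τ‖ ^ 2 := by
    rw [Finset.sum_comm, hunit, mul_one]
    exact (sum_norm_sq_le_traceNorm_sq R).trans (pow_le_pow_left₀ (traceNorm_nonneg _) hσ 2)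
  obtain ⟨τ, hpos, hτ⟩ := exists_pos_and_le_mul_of_sum_le
    (fun τ => Finset.sum_nonneg fun p _ => sq_nonneg ‖R p τ‖) (fun τ => sq_nonneg ‖Ψ τ‖)
    (hunit ▸ one_pos) htotal
  have hne : star (Ψ τ) ≠ 0 := by
    intro hzero
    rw [← norm_star, hzero, norm_zero] at hpos
    norm_num at hpos
  have hcol : ∀ p, Ψ p - (star (Ψ τ))⁻¹ * σ p τ = (star (Ψ τ))⁻¹ * R p τ := fun p => by
    rw [hR, Matrix.sub_apply, Matrix.vecMulVec_apply, Pi.star_apply]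
    field_simp
  refine ⟨τ, (star (Ψ τ))⁻¹, le_of_pow_le_pow_left₀ two_ne_zero hε ?_⟩
  rw [EuclideanSpace.norm_sq_eq]
  simp only [Pi.sub_apply, hcol, norm_mul, norm_inv, norm_star, mul_pow, ← Finset.mul_sum]
  rw [inv_pow, inv_mul_le_iff₀ hpos, mul_comm]
  exact hτ

end Column

section GroundState

/-- The inverse temperature, in units of `log (N / η)`, at which the excited states of a
Hamiltonian with gap `Δ` and at most `N ^ (κ * (1 + E))` levels up to energy `E` above the ground
state have total weight `O(η)` relative to the ground state. -/
def coolingConst (Δ κ : ℝ) : ℝ := (2 * κ + 1) / (Δ / (1 + Δ))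

theorem coolingConst_nonneg {Δ κ : ℝ} (hΔ : 0 ≤ Δ) (hκ : 0 ≤ κ) : 0 ≤ coolingConst Δ κ := by
  unfold coolingConst
  positivity

theorem traceNorm_sub_smul_le {n : Type*} [Fintype n] [DecidableEq n] {P ρ ρ' : Matrix n n ℂ}
    {z : ℂ} {η : ℝ} (hη₀ : 0 ≤ η) (hη : η ≤ 1 / 2) (hP : traceNorm P ≤ 1)
    (hρ : traceNorm (P - z • ρ) ≤ 2 * η) (hρ' : traceNorm (ρ - ρ') ≤ η * traceNorm ρ) :
    traceNorm (P - z • ρ') ≤ 4 * η := by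
  have hmass : traceNorm (z • ρ) ≤ 2 := by
    have htriangle := traceNorm_sub_le P (P - z • ρ)
    rw [sub_sub_cancel] at htriangle
    linarith
  have hscaled : traceNorm (z • (ρ - ρ')) ≤ η * 2 := calc
    traceNorm (z • (ρ - ρ')) = ‖z‖ * traceNorm (ρ - ρ') := traceNorm_smul _ _
    _ ≤ ‖z‖ * (η * traceNorm ρ) := by gcongr
    _ = η * traceNorm (z • ρ) := by rw [traceNorm_smul]; ring
    _ ≤ η * 2 := by gcongr
  have hsplit : P - z • ρ' = (P - z • ρ) + z • (ρ - ρ') := by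
    rw [smul_sub]
    abel
  rw [hsplit]
  linarith [traceNorm_add_le (P - z • ρ) (z • (ρ - ρ'))]

variable {V : Type u} [Fintype V] [DecidableEq V] {d : ℕ} {G : SimpleGraph V}
  [DecidableRel G.Adj] {h : G.edgeSet → Op V d} {Ψ : (V → Fin d) → ℂ} {E₀ Δ κ : ℝ}

theorem exists_traceNorm_groundState_sub_smul_gibbs_le (hh : IsInteraction G h)
    (hΨ : IsGappedGroundState (hamiltonian h) Ψ E₀ Δ) (hΔ : 0 < Δ) (hκ : 0 ≤ κ)
    (hN : 1 ≤ Fintype.card V)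
    (hcount : ∀ E : ℝ, 0 ≤ E → (levelCount (isHermitian_hamiltonian hh) (E₀ + E) : ℝ) ≤
      (Fintype.card V : ℝ) ^ (κ * (1 + E)))
    {η : ℝ} (hη₀ : 0 < η) (hη : η ≤ 1 / 2) :
    ∃ z : ℂ, traceNorm (Matrix.vecMulVec Ψ (star Ψ) -
      z • gibbs (coolingConst Δ κ * Real.log (Fintype.card V / η)) h) ≤ 2 * η := by
  obtain ⟨i₀, hE₀, hgap, hproj⟩ := hΨ.exists_index hΔ (isHermitian_hamiltonian hh)
  have hN' : (1 : ℝ) ≤ Fintype.card V := Nat.one_le_cast.2 hN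
  have hlog : 0 ≤ Real.log (Fintype.card V / η) :=
    log_div_nonneg hN' hη₀ (by linarith)
  refine ⟨_, (traceNorm_projection_sub_gibbs_le (isHermitian_hamiltonian hh) hE₀ hproj).trans
    (sum_exp_neg_mul_le_two_mul hN' hκ (fun E hE => ?_) hΔ (fun i hi => ?_) ?_ ?_ hη)⟩
  · refine (Nat.cast_le.2 (Finset.card_le_card fun i hi => ?_)).trans (hcount E hE)
    rw [Finset.mem_filter] at hi ⊢
    exact ⟨Finset.mem_univ i, by linarith [hi.2]⟩
  · linarith [hgap i (Finset.ne_of_mem_erase hi)]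
  · exact mul_nonneg (coolingConst_nonneg hΔ.le hκ) hlog
  · refine le_trans (le_of_eq ?_) (rpow_mul_exp_neg_le hN' hκ hη₀ (by linarith))
    rw [coolingConst]
    congr 3
    field_simp

theorem exists_groundState_approx [NeZero d] (hG : ∀ v, 0 < G.degree v)
    (hK : 2 ≤ G.edgeFinset.card) (hh : IsInteraction G h)
    (hΨ : IsGappedGroundState (hamiltonian h) Ψ E₀ Δ) (hΔ : 0 < Δ) (hκ : 0 ≤ κ)
    (hcount : ∀ E : ℝ, 0 ≤ E → (levelCount (isHermitian_hamiltonian hh) (E₀ + E) : ℝ) ≤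
      (Fintype.card V : ℝ) ^ (κ * (1 + E)))
    {ε : ℝ} (hε₀ : 0 < ε) (hε : ε ≤ 1) :
    ∃ D : ℕ, (D : ℝ) ≤ Real.exp (9 * bondConst (coolingConst Δ κ) d *
        Real.log (Fintype.card V / ε) ^ 2) ∧
      (∃ σ : Op V d, IsPEPO G D σ ∧ traceNorm (Matrix.vecMulVec Ψ (star Ψ) - σ) ≤ ε) ∧
      ∃ Φ : (V → Fin d) → ℂ, IsPEPS G D Φ ∧ ‖WithLp.toLp 2 (Ψ - Φ)‖ ≤ ε := by
  have hN : 2 ≤ Fintype.card V := by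
    have hsq := card_edgeFinset_le_sq_card (G := G)
    nlinarith
  have : Nonempty V := Fintype.card_pos_iff.1 (by omega)
  have hb := coolingConst_nonneg hΔ.le hκ
  have hlog₀ : 0 ≤ Real.log (Fintype.card V / (ε / 4)) :=
    log_div_nonneg (by exact_mod_cast one_le_two.trans hN) (by linarith) (by linarith)
  obtain ⟨M, L, -, -, -, herr, hpepo⟩ := exists_truncatedTrotter_approx hG
    (K := Fintype.card G.edgeSet) (by rwa [← SimpleGraph.edgeFinset_card])
    (Fintype.equivFin G.edgeSet).symm hh hb (mul_nonneg hb hlog₀) le_rfl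
    (ε := ε / 4) (by positivity) (by linarith)
  obtain ⟨D, hD, -, hDexp⟩ := hpepo (d ^ 2) (Nat.one_le_pow _ _ (NeZero.pos d)) le_rfl
    (schmidtRankLE_trotterTerm _ hh _ M)
  have hP : traceNorm (Matrix.vecMulVec Ψ (star Ψ)) ≤ 1 :=
    (traceNorm_vecMulVec_star_le Ψ Ψ).trans (by rw [norm_toLp_eq_one hΨ.1, one_mul])
  obtain ⟨z, hgibbs⟩ := exists_traceNorm_groundState_sub_smul_gibbs_le hh hΨ hΔ hκ (by omega) hcount
    (η := ε / 4) (by positivity) (by linarith)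
  have hσ := traceNorm_sub_smul_le (by positivity) (by linarith) hP hgibbs herr
  rw [mul_div_cancel₀ _ four_ne_zero] at hσ
  refine ⟨D, hDexp.trans (Real.exp_le_exp.2 ?_), ⟨_, hD.smul z, hσ⟩, ?_⟩
  · have hlog := log_div_div_four_le (N := Fintype.card V) (by exact_mod_cast hN) hε₀ hε
    have hsq := mul_le_mul_of_nonneg_left (pow_le_pow_left₀ hlog₀ hlog 2) (bondConst_pos hb d).le
    linarith
  · obtain ⟨τ, y, hy⟩ := exists_norm_sub_smul_column_le hΨ.1 hσ
    exact ⟨_, ((hD.smul z).smul y).isPEPS_col τ, hy⟩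

end GroundState

section Connected

theorem degree_pos_of_connected {V : Type*} [Fintype V] {G : SimpleGraph V} [DecidableRel G.Adj]
    (hG : G.Connected) (hE : Nonempty G.edgeSet) (v : V) : 0 < G.degree v := by
  obtain ⟨a, b, hab⟩ := SimpleGraph.ne_bot_iff_exists_adj.1
    (SimpleGraph.edgeSet_nonempty.1 (Set.nonempty_coe_sort.1 hE))
  have : Nontrivial V := hab.nontrivial
  exact hG.preconnected.degree_pos_of_nontrivial v

theorem mul_log_le_mul_log_div {b N ε : ℝ} (hb : 0 ≤ b) (hN : 0 < N) (hε₀ : 0 < ε) (hε : ε ≤ 1) :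
    b * Real.log N ≤ b * Real.log (N / ε) := by
  gcongr
  exact le_div_self hN.le hε₀ hε

end Connected

end

end GibbsPEPO

theorem mainTheorem1_general :
    (∀ b : ℝ, 0 ≤ b → ∃ (C : ℝ) (p : ℕ), 0 < C ∧
      ∀ d : ℕ, 1 ≤ d → ∃ C' : ℝ, 0 < C' ∧
      ∀ (V : Type u) [Fintype V] [DecidableEq V] (G : SimpleGraph V) [DecidableRel G.Adj]
        (K : ℕ) (ord : Fin K ≃ G.edgeSet) (h : G.edgeSet → GibbsPEPO.Op V d) (β ε : ℝ),
        (∀ v, 0 < G.degree v) → 2 ≤ K → GibbsPEPO.IsInteraction G h →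
        0 ≤ β → β ≤ b * Real.log (Fintype.card V / ε) → 0 < ε → ε ≤ 1 →
        ∃ M L : ℕ, 1 ≤ M ∧ (M : ℝ) ≤ C * (K / ε) ^ p ∧ (L : ℝ) ≤ C * Real.log (K / ε) ∧
          GibbsPEPO.traceNorm
              (GibbsPEPO.gibbs β h - GibbsPEPO.truncatedTrotter ord h β M L) ≤
            ε * GibbsPEPO.traceNorm (GibbsPEPO.gibbs β h) ∧
          (∀ i, GibbsPEPO.SchmidtRankLE (ord (GibbsPEPO.column K i) : Sym2 V) (d ^ 2)
            (GibbsPEPO.trotterTerm ord h β M i)) ∧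
          ∀ s : ℕ, 1 ≤ s → s ≤ d ^ 2 →
            (∀ i, GibbsPEPO.SchmidtRankLE (ord (GibbsPEPO.column K i) : Sym2 V) s
              (GibbsPEPO.trotterTerm ord h β M i)) →
            ∃ D : ℕ, GibbsPEPO.IsPEPO G D (GibbsPEPO.truncatedTrotter ord h β M L) ∧
              D ≤ L ^ 2 * (s * M) ^ (2 * L) ∧
              (D : ℝ) ≤ Real.exp (C' * Real.log (Fintype.card V / ε) ^ 2)) ∧
    (∀ (d : ℕ) (Δ κ : ℝ), 1 ≤ d → 0 < Δ → 0 ≤ κ → ∃ C : ℝ, 0 < C ∧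
      ∀ (V : Type u) [Fintype V] [DecidableEq V] (G : SimpleGraph V) [DecidableRel G.Adj]
        (h : G.edgeSet → GibbsPEPO.Op V d) (hh : GibbsPEPO.IsInteraction G h)
        (Ψ : (V → Fin d) → ℂ) (E₀ ε : ℝ),
        (∀ v, 0 < G.degree v) → 2 ≤ G.edgeFinset.card →
        GibbsPEPO.IsGappedGroundState (GibbsPEPO.hamiltonian h) Ψ E₀ Δ →
        (∀ E : ℝ, 0 ≤ E →
          (GibbsPEPO.levelCount (GibbsPEPO.isHermitian_hamiltonian hh) (E₀ + E) : ℝ) ≤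
            (Fintype.card V : ℝ) ^ (κ * (1 + E))) →
        0 < ε → ε ≤ 1 →
        ∃ D : ℕ, (D : ℝ) ≤ Real.exp (C * Real.log (Fintype.card V / ε) ^ 2) ∧
          (∃ σ : GibbsPEPO.Op V d, GibbsPEPO.IsPEPO G D σ ∧
            GibbsPEPO.traceNorm (Matrix.vecMulVec Ψ (star Ψ) - σ) ≤ ε) ∧
          ∃ Φ : (V → Fin d) → ℂ, GibbsPEPO.IsPEPS G D Φ ∧
            ‖WithLp.toLp 2 (Ψ - Φ)‖ ≤ ε) := by
  constructor
  · intro b hb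
    refine ⟨GibbsPEPO.trotterConst b, 4, one_pos.trans_le (GibbsPEPO.one_le_trotterConst hb),
      fun d hd => ?_⟩
    have : NeZero d := ⟨by omega⟩
    refine ⟨GibbsPEPO.bondConst b d, GibbsPEPO.bondConst_pos hb d, ?_⟩
    intro V _ _ G _ K ord h β ε hG hK hh hβ hβb hε₀ hε
    obtain ⟨M, L, hM, hMle, hLle, herr, hpepo⟩ :=
      GibbsPEPO.exists_truncatedTrotter_approx hG hK ord hh hb hβ hβb hε₀ hε
    exact ⟨M, L, hM, hMle, hLle, herr, GibbsPEPO.schmidtRankLE_trotterTerm ord hh β M, hpepo⟩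
  · intro d Δ κ hd hΔ hκ
    have : NeZero d := ⟨by omega⟩
    refine ⟨9 * GibbsPEPO.bondConst (GibbsPEPO.coolingConst Δ κ) d, mul_pos (by norm_num)
      (GibbsPEPO.bondConst_pos (GibbsPEPO.coolingConst_nonneg hΔ.le hκ) d), ?_⟩
    intro V _ _ G _ h hh Ψ E₀ ε hG hK hΨ hcount hε₀ hε
    exact GibbsPEPO.exists_groundState_approx hG hK hh hΨ hΔ hκ hcount hε₀ hε

theorem mainTheorem1 :
    (∀ b : ℝ, 0 ≤ b → ∃ (C : ℝ) (p : ℕ), 0 < C ∧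
      ∀ d : ℕ, 1 ≤ d → ∃ C' : ℝ, 0 < C' ∧
      ∀ (V : Type u) [Fintype V] [DecidableEq V] (G : SimpleGraph V) [DecidableRel G.Adj]
        (z : ℕ) (γ : ℝ) (K : ℕ) (ord : Fin K ≃ G.edgeSet)
        (h : G.edgeSet → GibbsPEPO.Op V d) (β ε : ℝ),
        G.Connected → (∀ v, G.degree v < z) → GibbsPEPO.LatticeGrowthLE G γ → 2 ≤ K →
        GibbsPEPO.IsInteraction G h →
        0 ≤ β → β ≤ b * Real.log (Fintype.card V) → 0 < ε → ε ≤ 1 →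
        ∃ M L : ℕ, 1 ≤ M ∧ (M : ℝ) ≤ C * (K / ε) ^ p ∧ (L : ℝ) ≤ C * Real.log (K / ε) ∧
          GibbsPEPO.traceNorm
              (GibbsPEPO.gibbs β h - GibbsPEPO.truncatedTrotter ord h β M L) ≤
            ε * GibbsPEPO.traceNorm (GibbsPEPO.gibbs β h) ∧
          (∀ i, GibbsPEPO.SchmidtRankLE (ord (GibbsPEPO.column K i) : Sym2 V) (d ^ 2)
            (GibbsPEPO.trotterTerm ord h β M i)) ∧
          ∀ s : ℕ, 1 ≤ s → s ≤ d ^ 2 →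
            (∀ i, GibbsPEPO.SchmidtRankLE (ord (GibbsPEPO.column K i) : Sym2 V) s
              (GibbsPEPO.trotterTerm ord h β M i)) →
            ∃ D : ℕ, GibbsPEPO.IsPEPO G D (GibbsPEPO.truncatedTrotter ord h β M L) ∧
              D ≤ L ^ 2 * (s * M) ^ (2 * L) ∧
              (D : ℝ) ≤ Real.exp (C' * Real.log (Fintype.card V / ε) ^ 2)) ∧
    (∀ (d : ℕ) (Δ κ : ℝ), 1 ≤ d → 0 < Δ → 0 ≤ κ → ∃ C : ℝ, 0 < C ∧
      ∀ (V : Type u) [Fintype V] [DecidableEq V] (G : SimpleGraph V) [DecidableRel G.Adj]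
        (z : ℕ) (γ : ℝ) (h : G.edgeSet → GibbsPEPO.Op V d)
        (hh : GibbsPEPO.IsInteraction G h) (Ψ : (V → Fin d) → ℂ) (E₀ ε : ℝ),
        G.Connected → (∀ v, G.degree v < z) → GibbsPEPO.LatticeGrowthLE G γ →
        2 ≤ G.edgeFinset.card →
        GibbsPEPO.IsGappedGroundState (GibbsPEPO.hamiltonian h) Ψ E₀ Δ →
        (∀ E : ℝ, 0 ≤ E →
          (GibbsPEPO.levelCount (GibbsPEPO.isHermitian_hamiltonian hh) (E₀ + E) : ℝ) ≤
            (Fintype.card V : ℝ) ^ (κ * (1 + E))) →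
        0 < ε → ε ≤ 1 →
        ∃ D : ℕ, (D : ℝ) ≤ Real.exp (C * Real.log (Fintype.card V / ε) ^ 2) ∧
          (∃ σ : GibbsPEPO.Op V d, GibbsPEPO.IsPEPO G D σ ∧
            GibbsPEPO.traceNorm (Matrix.vecMulVec Ψ (star Ψ) - σ) ≤ ε) ∧
          ∃ Φ : (V → Fin d) → ℂ, GibbsPEPO.IsPEPS G D Φ ∧
            ‖WithLp.toLp 2 (Ψ - Φ)‖ ≤ ε) := by
  refine ⟨fun b hb => ?_, fun d Δ κ hd hΔ hκ => ?_⟩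
  · obtain ⟨C, p, hC, hgibbs⟩ := mainTheorem1_general.1 b hb
    refine ⟨C, p, hC, fun d hd => ?_⟩
    obtain ⟨C', hC', hgibbs⟩ := hgibbs d hd
    refine ⟨C', hC', fun V _ _ G _ _ _ K ord h β ε hG _ _ hK hh hβ hβb hε₀ hε => ?_⟩
    have hN : (0 : ℝ) < Fintype.card V := mod_cast Fintype.card_pos_iff.2 hG.nonempty
    exact hgibbs V G K ord h β ε
      (GibbsPEPO.degree_pos_of_connected hG ⟨ord ⟨0, by omega⟩⟩) hK hh hβ
      (hβb.trans (GibbsPEPO.mul_log_le_mul_log_div hb hN hε₀ hε)) hε₀ hε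
  · obtain ⟨C, hC, hground⟩ := mainTheorem1_general.2 d Δ κ hd hΔ hκ
    refine ⟨C, hC, fun V _ _ G _ _ _ h hh Ψ E₀ ε hG _ _ hK => ?_⟩
    have hE : Nonempty G.edgeSet :=
      Fintype.card_pos_iff.1 (by rw [← SimpleGraph.edgeFinset_card]; omega)
    exact hground V G h hh Ψ E₀ ε (GibbsPEPO.degree_pos_of_connected hG hE) hK
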